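/- Let $\Omega$ be a finite set and let $f:2^\Omega\to\mathbb{R}_{\ge 0}$ be a (not necessarily monotone) submodular function, i.e. $f(S)+f(T)\ge f(S\cup T)+f(S\cap T)$ for all $S,T\subseteq\Omega$, with $f(\emptyset)=0$. For $S\subseteq\Omega$ write $f_S(x)=f(S\cup\{x\})-f(S)$. Let $\Omega$ be partitioned into groups $g_1,\dots,g_r$, and consider the partition matroid whose independent sets are the sets $S$ with $|S\cap g_i|\le 1$ for all $i$. In the contiguous-partitions secretary model the groups arrive one after the other, in an arbitrary fixed order $g_1,\dots,g_r$, and the elements of each group arrive in uniformly random order, independently for different groups. Dynkin's algorithm, applied to a stream of $n$ elements with real values, observes the first $\lfloor n/\mathrm{e}\rfloor$ elements (the sample) and selects the first later element that is larger than all elements of the sample, if there is one; ties between equal values are broken by a fixed linear order on $\Omega$. Consider the following algorithm. It first chooses one of three modes A, B, C uniformly at random and sets $S_0=\emptyset$. When group $g_i$ arrives, it runs Dynkin's algorithm on the elements of $g_i$ with the values $f_{S_{i-1}}(\cdot)$. If an element $x$ is selected, a fair coin is flipped: in modes A and B, $S_i=S_{i-1}\cup\{x\}$ if the coin shows heads and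 $S_i=S_{i-1}$ otherwise; in mode C, $S_i=S_{i-1}\cup\{x\}$ if the coin shows tails and $S_i=S_{i-1}$ otherwise. If no element is selected, $S_i=S_{i-1}$. In modes A and C the output is $S_r$; in mode B each element of $S_r$ is discarded independently with probability $1/2$, and the remaining set is the output. The mode, the coins, the discarding decisions and the internal orders of the groups are independent. Then the output $S$ is always independent in the partition matroid, and the algorithm is a $(3+6\mathrm{e})$-approximation: $$\max\{f(C): C\subseteq\Omega \text{ independent}\}\;\le\;(3+6\mathrm{e})\cdot\mathbb{E}[f(S)].$$ -/

import Mathlib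

open scoped BigOperators

namespace ContiguousSecretary

/-- `f(S) + f(T) ≥ f(S ∪ T) + f(S ∩ T)` for all `S, T`. -/
def IsSubmodular {α : Type*} [DecidableEq α] (f : Finset α → ℝ) : Prop :=
  ∀ S T : Finset α, f (S ∪ T) + f (S ∩ T) ≤ f S + f T

/-- The marginal value `f_S({x}) = f(S ∪ {x}) - f(S)`. -/
def marginal {α : Type*} [DecidableEq α] (f : Finset α → ℝ) (S : Finset α) (x : α) : ℝ :=
  f (S ∪ {x}) - f S

/-- The independent sets of the partition matroid whose groups are the fibres of `grp`:
at most one element from each group. -/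
def IsIndep {α : Type*} {r : ℕ} (grp : α → Fin r) (S : Finset α) : Prop :=
  ∀ j : Fin r, (S.filter (fun x => grp x = j)).card ≤ 1

instance {α : Type*} {r : ℕ} (grp : α → Fin r) : DecidablePred (IsIndep grp) :=
  fun S => inferInstanceAs (Decidable (∀ j : Fin r, (S.filter (fun x => grp x = j)).card ≤ 1))

theorem isIndep_empty {α : Type*} {r : ℕ} (grp : α → Fin r) : IsIndep grp ∅ := by
  intro j
  simp

/-- The offline optimum: the maximum of `f` over the independent sets. -/
noncomputable def opt {α : Type*} [Fintype α] {r : ℕ} (grp : α → Fin r)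
    (f : Finset α → ℝ) : ℝ :=
  ((Finset.univ : Finset (Finset α)).filter (IsIndep grp)).sup'
    ⟨∅, Finset.mem_filter.mpr ⟨Finset.mem_univ _, isIndep_empty grp⟩⟩ f

/-- `x` is larger than `y` under the values `v`; ties are broken by the fixed linear order
on the elements. -/
def Beats {α : Type*} [LinearOrder α] (v : α → ℝ) (x y : α) : Prop :=
  v y < v x ∨ (v y = v x ∧ y < x)

noncomputable instance {α : Type*} [LinearOrder α] (v : α → ℝ) (x y : α) :
    Decidable (Beats v x y) :=
  inferInstanceAs (Decidable (v y < v x ∨ (v y = v x ∧ y < x)))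

/-- Dynkin's algorithm on the stream `l` (in order of arrival) with values `v`: the first
`⌊n / e⌋` of the `n` elements are the sample, and the first later element which is larger than
all elements of the sample is selected, if there is one. -/
noncomputable def dynkin {α : Type*} [LinearOrder α] (v : α → ℝ) (l : List α) : Option α :=
  let s : ℕ := ⌊(l.length : ℝ) / Real.exp 1⌋₊
  (l.drop s).find? (fun x => decide (∀ y ∈ l.take s, Beats v x y))

/-- The three modes of the algorithm. -/
inductive Mode
  | A
  | B
  | C
  deriving DecidableEq

instance : Fintype Mode where
  elems := {Mode.A, Mode.B, Mode.C}
  complete := by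
    intro m
    cases m <;> decide

/-- All the randomness: the internal arrival order of each group (a bijection from positions
to the elements of the group), the mode, one coin for each group (`true` is heads), and one
discarding coin for each element (`true` means that the element is kept). The uniform
distribution on this finite type makes all these components uniform and independent. -/
abbrev Outcome {α : Type*} [Fintype α] [DecidableEq α] {r : ℕ} (grp : α → Fin r) : Type _ :=
  (∀ j : Fin r, Fin (Fintype.card {x : α // grp x = j}) ≃ {x : α // grp x = j}) ×
    Mode × (Fin r → Bool) × (α → Bool)

section Algorithm

variable {α : Type*} [Fintype α] [LinearOrder α] {r : ℕ} {grp : α → Fin r}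

/-- The elements of group `j` in order of arrival. -/
def stream (ω : Outcome grp) (j : Fin r) : List α :=
  List.ofFn (fun i => ((ω.1 j i : {x : α // grp x = j}) : α))

/-- Whether the coin of group `j` lets the selected element be added: heads in modes `A`
and `B`, tails in mode `C`. -/
def accepts (ω : Outcome grp) (j : Fin r) : Bool :=
  match ω.2.1 with
  | Mode.A => ω.2.2.1 j
  | Mode.B => ω.2.2.1 j
  | Mode.C => !(ω.2.2.1 j)

/-- The processing of group `j` when the set selected so far is `S`. -/
noncomputable def step (f : Finset α → ℝ) (ω : Outcome grp) (S : Finset α) (j : Fin r) :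
    Finset α :=
  match dynkin (marginal f S) (stream ω j) with
  | none => S
  | some x => if accepts ω j then S ∪ {x} else S

/-- The set `S_r`: the groups arrive in the order `0, 1, …, r - 1`. -/
noncomputable def selected (f : Finset α → ℝ) (ω : Outcome grp) : Finset α :=
  (List.finRange r).foldl (step f ω) ∅

/-- The output: `S_r` in modes `A` and `C`; in mode `B` each element of `S_r` is discarded
according to its own coin. -/
noncomputable def output (f : Finset α → ℝ) (ω : Outcome grp) : Finset α :=
  match ω.2.1 with
  | Mode.A => selected f ω
  | Mode.B => (selected f ω).filter (fun x => ω.2.2.2 x = true)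
  | Mode.C => selected f ω

end Algorithm

/-- The expected value of the output of the algorithm, over the random internal orders of the
groups and the coins of the algorithm. -/
noncomputable def expectedValue {α : Type*} [Fintype α] [LinearOrder α] {r : ℕ}
    (grp : α → Fin r) (f : Finset α → ℝ) : ℝ :=
  (∑ ω : Outcome grp, f (output f ω)) / (Fintype.card (Outcome grp) : ℝ)

end ContiguousSecretary

/-! Let `S` be the selected set before discarding and `C` an independent set. Modes A and C give `S`
the same law, so with `a = E f(S)` and `b` the expected value after discarding, the output is worth
`(2a + b) / 3`. It therefore suffices that `f(C) ≤ (1 + 2e)(2a + b)`.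

An element `x` is accepted, given the earlier groups, with probability `prob`, half of Dynkin's
selection probability. This is exactly 1/2 for an element alone in its group (a "single") and at
most 1/4 otherwise. Two values are attached to `x`: its marginal when its group arrives
(`arrivalValue`), and its marginal when all accepted singles are present as well (`lateValue`). A
single is always picked, so its acceptance depends only on its own coin. Hence, for a non-single
`x`, neither value depends on the randomness of the group of `x`, and the averaging identity
`sum_mem_state` applies.

Upper bound on `f(C)`. As no element is accepted with probability above 1/2, `f(C) ≤ 2 E f(S ∪ C)`
(`sum_union_ge`). Submodularity bounds `f(S ∪ C)` by `f(S)` plus contributions of the members of `C`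
(`sum_union_le`). Inside a group of size at least two, `weighted_selectProb_ge` says that Dynkin's
algorithm often selects the member of `C` or something better, so its late value is paid for by
gains of its group (`group_tradeoff`).

Lower bounds on `a` and `b`. Without monotonicity, losses must be controlled.
`IsSubmodular.exists_dominated` tracks `f(S ∪ Y)`, where `Y` collects candidates that were harmful
on arrival. Every harmful candidate lowers this value, whereas it is accepted only with small
probability, so `f ≥ 0` limits the harm (`gain_add_loss_le`). Treating singles and non-singles
separately gives `gain_add_lateGain_le`. For `b`, flipping the coins of a subset pairs outcomes so
that submodularity compares independent discarding with keeping all or none of that subset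
(`IsSubmodular.sum_keep_ge`, `total_keep_ge`).

`card_mul_le` is a linear combination of these inequalities. It fits only because the constants 7.12
and 10.98 of the Dynkin bound lie just below what `e` allows. -/

namespace ContiguousSecretary

/-! ### Counting arrival orders by symmetry of positions. -/

section Counting

open Classical in
/-- The number of arrival orders with a given property. -/
noncomputable def countOrders {n : ℕ} {G : Type*} [Fintype G] (P : (Fin n ≃ G) → Prop) : ℝ :=
  ((Finset.univ.filter P).card : ℝ)

variable {n : ℕ} {G : Type*} [Fintype G]

theorem countOrders_nonneg (P : (Fin n ≃ G) → Prop) : 0 ≤ countOrders P := by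
  unfold countOrders
  positivity

theorem countOrders_mono {P Q : (Fin n ≃ G) → Prop} (h : ∀ σ, P σ → Q σ) :
    countOrders P ≤ countOrders Q := by
  classical
  unfold countOrders
  exact_mod_cast Finset.card_le_card (Finset.monotone_filter_right _ (fun σ _ => h σ))

theorem countOrders_congr {P Q : (Fin n ≃ G) → Prop} (h : ∀ σ, P σ ↔ Q σ) :
    countOrders P = countOrders Q :=
  congrArg _ (funext fun σ => propext (h σ))

theorem countOrders_comp (P : (Fin n ≃ G) → Prop) (π : Equiv.Perm (Fin n)) :
    countOrders (fun σ => P (π.trans σ)) = countOrders P := by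
  classical
  unfold countOrders
  norm_cast
  refine Finset.card_bij (fun σ _ => π.trans σ) ?_ ?_ ?_
  · intro σ hσ
    simpa using hσ
  · intro σ _ τ _ h
    ext i
    have := congrArg (fun ρ : Fin n ≃ G => ρ (π.symm i)) h
    simpa using this
  · intro σ hσ
    refine ⟨π.symm.trans σ, ?_, ?_⟩
    · have : π.trans (π.symm.trans σ) = σ := by ext i; simp
      simpa [this] using hσ
    · ext i; simp

theorem countOrders_biUnion {ι : Type*} (V : Finset ι) (P : (Fin n ≃ G) → Prop)
    (R : (Fin n ≃ G) → ι → Prop)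
    (huniq : ∀ σ, P σ → ∀ i ∈ V, ∀ j ∈ V, R σ i → R σ j → i = j) :
    countOrders (fun σ => P σ ∧ ∃ i ∈ V, R σ i)
      = ∑ i ∈ V, countOrders (fun σ => P σ ∧ R σ i) := by
  classical
  unfold countOrders
  norm_cast
  rw [← Finset.card_biUnion]
  · congr 1
    ext σ
    simp only [Finset.mem_filter, Finset.mem_univ, true_and, Finset.mem_biUnion]
    exact ⟨fun ⟨h, i, hi, hr⟩ => ⟨i, hi, h, hr⟩, fun ⟨i, hi, h, hr⟩ => ⟨h, i, hi, hr⟩⟩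
  · intro i hi j hj hij
    rw [Function.onFun, Finset.disjoint_left]
    intro σ h1 h2
    simp only [Finset.mem_filter, Finset.mem_univ, true_and] at h1 h2
    exact hij (huniq σ h1.1 i hi j hj h1.2 h2.2)

/-- If a property is invariant under permuting the positions in `U`, and determines a unique
position in `U` equivariantly, then that position is uniformly distributed on `U`. -/
theorem countOrders_location (U V : Finset (Fin n)) (hVU : V ⊆ U) (P : (Fin n ≃ G) → Prop)
    (R : (Fin n ≃ G) → Fin n → Prop)
    (hP : ∀ a ∈ U, ∀ b ∈ U, ∀ σ : Fin n ≃ G, P σ → P ((Equiv.swap a b).trans σ))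
    (hR : ∀ a ∈ U, ∀ b ∈ U, ∀ σ : Fin n ≃ G, P σ → R σ a → R ((Equiv.swap a b).trans σ) b)
    (hex : ∀ σ, P σ → ∃ m ∈ U, R σ m)
    (huniq : ∀ σ, P σ → ∀ i ∈ U, ∀ j ∈ U, R σ i → R σ j → i = j) :
    (U.card : ℝ) * countOrders (fun σ => P σ ∧ ∃ m ∈ V, R σ m)
      = V.card * countOrders P := by
  have hswap : ∀ a b, ∀ σ : Fin n ≃ G,
      (Equiv.swap a b).trans ((Equiv.swap a b).trans σ) = σ := by
    intro a b σ
    ext i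
    simp
  have hle : ∀ a ∈ U, ∀ b ∈ U,
      countOrders (fun σ => P σ ∧ R σ a) ≤ countOrders (fun σ => P σ ∧ R σ b) := by
    intro a ha b hb
    rw [← countOrders_comp (fun σ => P σ ∧ R σ b) (Equiv.swap a b)]
    exact countOrders_mono fun σ h => ⟨hP a ha b hb σ h.1, hR a ha b hb σ h.1 h.2⟩
  have heq : ∀ a ∈ U, ∀ b ∈ U,
      countOrders (fun σ => P σ ∧ R σ a) = countOrders (fun σ => P σ ∧ R σ b) :=
    fun a ha b hb => le_antisymm (hle a ha b hb) (hle b hb a ha)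
  have hall : countOrders P = ∑ i ∈ U, countOrders (fun σ => P σ ∧ R σ i) := by
    rw [← countOrders_biUnion U P R huniq]
    exact countOrders_congr fun σ => ⟨fun h => ⟨h, hex σ h⟩, fun h => h.1⟩
  rw [countOrders_biUnion V P R
    (fun σ h i hi j hj => huniq σ h i (hVU hi) j (hVU hj)), hall]
  -- By symmetry all positions of `U` carry the same count, so both sides are multiples of the count
  -- at a single `u`.
  rcases U.eq_empty_or_nonempty with rfl | ⟨u, hu⟩
  · simp [Finset.subset_empty.mp hVU]
  · rw [Finset.sum_congr rfl (fun i hi => heq i hi u hu),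
      Finset.sum_congr rfl (fun i hi => heq i (hVU hi) u hu)]
    simp only [Finset.sum_const, nsmul_eq_mul]
    ring

theorem countOrders_true (hn : Fintype.card G = n) :
    countOrders (fun _ : Fin n ≃ G => True) = (Nat.factorial n : ℝ) := by
  classical
  unfold countOrders
  have e : Fin n ≃ G := (Fintype.equivFinOfCardEq hn).symm
  simp [Finset.filter_true, Finset.card_univ, Fintype.card_equiv e]

/-- Position of a single element. -/
theorem countOrders_one (hn : Fintype.card G = n) (x : G) (t : Fin n) :
    (n : ℝ) * countOrders (fun σ : Fin n ≃ G => σ t = x) = Nat.factorial n := by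
  have h := countOrders_location (G := G) (Finset.univ) {t} (Finset.subset_univ _)
    (fun _ => True) (fun σ m => σ m = x) (by simp) (by simp)
    (fun σ _ => ⟨σ.symm x, by simp⟩)
    (fun σ _ i _ j _ hi hj => σ.injective (hi.trans hj.symm))
  simp only [Finset.card_univ, Fintype.card_fin, Finset.mem_singleton, exists_eq_left, true_and,
    Finset.card_singleton, Nat.cast_one, one_mul, countOrders_true hn] at h
  exact h

/-- One element at position `t` and another one later. -/
theorem countOrders_two {x y : G} (hxy : x ≠ y) (t : Fin n) :
    ((n : ℝ) - 1) * countOrders (fun σ : Fin n ≃ G => σ t = x ∧ t < σ.symm y)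
      = ((n : ℝ) - 1 - t) * countOrders (fun σ : Fin n ≃ G => σ t = x) := by
  have h := countOrders_location (G := G) (Finset.univ.erase t) (Finset.Ioi t)
    (by intro i hi; simp at hi ⊢; exact hi.ne')
    (fun σ => σ t = x) (fun σ m => σ m = y)
    (by
      intro a ha b hb σ h
      simp only [Finset.mem_erase, Finset.mem_univ, and_true] at ha hb
      simp [Equiv.swap_apply_of_ne_of_ne ha.symm hb.symm, h])
    (by simp)
    (by
      intro σ h
      refine ⟨σ.symm y, ?_, by simp⟩
      simp only [Finset.mem_erase, Finset.mem_univ, and_true]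
      rintro rfl
      simp at h
      exact hxy h.symm)
    (fun σ _ i _ j _ hi hj => σ.injective (hi.trans hj.symm))
  have e1 : ((Finset.univ.erase t).card : ℝ) = (n : ℝ) - 1 := by
    rw [Finset.card_erase_of_mem (Finset.mem_univ _), Finset.card_univ, Fintype.card_fin,
      Nat.cast_sub (by have := t.2; omega)]
    simp
  have e2 : ((Finset.Ioi t).card : ℝ) = (n : ℝ) - 1 - t := by
    rw [Fin.card_Ioi, Nat.cast_sub (by have := t.2; omega), Nat.cast_sub (by have := t.2; omega)]
    simp
  rw [e1, e2] at h
  rw [← h]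
  congr 1
  refine countOrders_congr fun σ => and_congr_right fun _ => ?_
  constructor
  · intro hlt
    exact ⟨σ.symm y, by simpa using hlt, by simp⟩
  · rintro ⟨m, hm, rfl⟩
    simpa using hm

/-- One element at position `t` and two others later. -/
theorem countOrders_three {x y z : G} (hxy : x ≠ y) (hxz : x ≠ z) (hyz : y ≠ z) (t : Fin n) :
    ((n : ℝ) - 2) * countOrders
        (fun σ : Fin n ≃ G => σ t = x ∧ t < σ.symm y ∧ t < σ.symm z)
      = ((n : ℝ) - 2 - t) * countOrders (fun σ : Fin n ≃ G => σ t = x ∧ t < σ.symm y) := by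
  have hj : ∀ j ∈ Finset.Ioi t, ((n : ℝ) - 2) * countOrders
        (fun σ : Fin n ≃ G => (σ t = x ∧ t < σ.symm z) ∧ σ j = y)
      = ((n : ℝ) - 2 - t) * countOrders (fun σ : Fin n ≃ G => σ t = x ∧ σ j = y) := by
    intro j hj
    have hjt : t < j := by simpa using hj
    have h := countOrders_location (G := G) ((Finset.univ.erase t).erase j)
      ((Finset.Ioi t).erase j)
      (by
        intro i hi
        simp only [Finset.mem_erase, Finset.mem_Ioi, Finset.mem_univ, and_true] at hi ⊢
        exact ⟨hi.1, hi.2.ne'⟩)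
      (fun σ => σ t = x ∧ σ j = y) (fun σ m => σ m = z)
      (by
        intro a ha b hb σ h
        simp only [Finset.mem_erase, Finset.mem_univ, and_true] at ha hb
        simp [Equiv.swap_apply_of_ne_of_ne ha.2.symm hb.2.symm,
          Equiv.swap_apply_of_ne_of_ne ha.1.symm hb.1.symm, h])
      (by simp)
      (by
        rintro σ ⟨h, h'⟩
        refine ⟨σ.symm z, ?_, by simp⟩
        simp only [Finset.mem_erase, Finset.mem_univ, and_true]
        constructor
        · rintro rfl
          simp at h'
          exact hyz h'.symm
        · rintro rfl
          simp at h
          exact hxz h.symm)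
      (fun σ _ i _ j _ hi hj => σ.injective (hi.trans hj.symm))
    have e1 : (((Finset.univ.erase t).erase j).card : ℝ) = (n : ℝ) - 2 := by
      rw [Finset.card_erase_of_mem (by simp [hjt.ne']),
        Finset.card_erase_of_mem (Finset.mem_univ _), Finset.card_univ, Fintype.card_fin]
      have h1 := t.2
      have h2 := j.2
      have h3 : (t : ℕ) < j := hjt
      rw [Nat.sub_sub, Nat.cast_sub (by omega)]
      norm_num
    have e2 : (((Finset.Ioi t).erase j).card : ℝ) = (n : ℝ) - 2 - t := by
      have h1 := t.2
      have h2 := j.2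
      have h3 : (t : ℕ) < j := hjt
      rw [Finset.card_erase_of_mem hj, Fin.card_Ioi, show n - 1 - (t : ℕ) - 1 = n - (2 + t) by omega,
        Nat.cast_sub (by omega)]
      push_cast
      ring
    rw [e1, e2] at h
    rw [← h]
    congr 1
    refine countOrders_congr fun σ => ?_
    constructor
    · rintro ⟨⟨h1, h2⟩, h3⟩
      refine ⟨⟨h1, h3⟩, σ.symm z, ?_, by simp⟩
      simp only [Finset.mem_erase, Finset.mem_Ioi]
      refine ⟨?_, h2⟩
      rintro rfl
      simp at h3
      exact hyz h3.symm
    · rintro ⟨⟨h1, h3⟩, m, hm, rfl⟩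
      simp only [Finset.mem_erase, Finset.mem_Ioi] at hm
      exact ⟨⟨h1, by simpa using hm.2⟩, h3⟩
  have s1 : countOrders (fun σ : Fin n ≃ G => σ t = x ∧ t < σ.symm y ∧ t < σ.symm z)
      = ∑ j ∈ Finset.Ioi t, countOrders
        (fun σ : Fin n ≃ G => (σ t = x ∧ t < σ.symm z) ∧ σ j = y) := by
    rw [← countOrders_biUnion _ _ (fun σ j => σ j = y)
      (fun σ _ i _ j _ hi hj => σ.injective (hi.trans hj.symm))]
    refine countOrders_congr fun σ => ?_
    constructor
    · rintro ⟨h1, h2, h3⟩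
      exact ⟨⟨h1, h3⟩, σ.symm y, by simpa using h2, by simp⟩
    · rintro ⟨⟨h1, h3⟩, m, hm, rfl⟩
      exact ⟨h1, by simpa using hm, h3⟩
  have s2 : countOrders (fun σ : Fin n ≃ G => σ t = x ∧ t < σ.symm y)
      = ∑ j ∈ Finset.Ioi t, countOrders (fun σ : Fin n ≃ G => σ t = x ∧ σ j = y) := by
    rw [← countOrders_biUnion _ _ (fun σ j => σ j = y)
      (fun σ _ i _ j _ hi hj => σ.injective (hi.trans hj.symm))]
    refine countOrders_congr fun σ => and_congr_right fun _ => ?_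
    constructor
    · intro h2
      exact ⟨σ.symm y, by simpa using h2, by simp⟩
    · rintro ⟨m, hm, rfl⟩
      simpa using hm
  rw [s1, s2, Finset.mul_sum, Finset.mul_sum]
  exact Finset.sum_congr rfl hj

/-- The largest of the first `t` elements is equally likely to be at each of the first `t`
positions. -/
theorem countOrders_argmax {L : Type*} [LinearOrder L] {key : G → L}
    (hkey : Function.Injective key) {s t : ℕ} (hst : s ≤ t) (ht0 : 0 < t) (htn : t ≤ n)
    (P : (Fin n ≃ G) → Prop)
    (hP : ∀ a b : Fin n, (a : ℕ) < t → (b : ℕ) < t → ∀ σ : Fin n ≃ G,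
      P σ → P ((Equiv.swap a b).trans σ)) :
    (t : ℝ) * countOrders (fun σ => P σ ∧ ∃ m : Fin n, (m : ℕ) < s ∧
        ∀ i : Fin n, (i : ℕ) < t → key (σ i) ≤ key (σ m)) = s * countOrders P := by
  have hcard : ∀ u ≤ n, (Finset.univ.filter (fun i : Fin n => (i : ℕ) < u)).card = u := by
    intro u hu
    rw [Fin.card_filter_val_lt]
    exact min_eq_right hu
  have h := countOrders_location (G := G) (Finset.univ.filter (fun i : Fin n => (i : ℕ) < t))
    (Finset.univ.filter (fun i : Fin n => (i : ℕ) < s))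
    (by
      intro i hi
      simp only [Finset.mem_filter, Finset.mem_univ, true_and] at hi ⊢
      omega)
    P (fun σ m => ∀ i : Fin n, (i : ℕ) < t → key (σ i) ≤ key (σ m))
    (by
      intro a ha b hb
      exact hP a b (by simpa using ha) (by simpa using hb))
    (by
      intro a ha b hb σ _ h i hi
      simp only [Finset.mem_filter, Finset.mem_univ, true_and] at ha hb
      simp only [Equiv.trans_apply, Equiv.swap_apply_right]
      apply h
      rw [Equiv.swap_apply_def]
      split_ifs <;> assumption)
    (by
      intro σ _
      obtain ⟨m, hm, hmax⟩ := Finset.exists_max_image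
        (Finset.univ.filter (fun i : Fin n => (i : ℕ) < t)) (fun i => key (σ i))
        ⟨⟨0, by omega⟩, by simpa using ht0⟩
      exact ⟨m, hm, fun i hi => hmax i (by simpa using hi)⟩)
    (by
      intro σ _ i hi j hj h1 h2
      simp only [Finset.mem_filter, Finset.mem_univ, true_and] at hi hj
      exact σ.injective (hkey (le_antisymm (h2 i hi) (h1 j hj))))
  rw [hcard t htn, hcard s (hst.trans htn)] at h
  rw [← h]
  congr 1
  refine countOrders_congr fun σ => and_congr_right fun _ => ?_
  simp

end Counting

/-! ### Selection probabilities of Dynkin's rule for the three best ranks. -/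

section Selection

variable {n : ℕ} {G : Type*} [Fintype G] {L : Type*} [LinearOrder L]

/-- The element `x` is the first one after the `s` sample elements that is larger than the whole
sample. -/
def Selects (key : G → L) (s : ℕ) (σ : Fin n ≃ G) (x : G) : Prop :=
  ∃ t : Fin n, s ≤ (t : ℕ) ∧ σ t = x ∧ (∀ i : Fin n, (i : ℕ) < s → key (σ i) < key x) ∧
    ∀ u : Fin n, s ≤ (u : ℕ) → u < t → ¬ ∀ i : Fin n, (i : ℕ) < s → key (σ i) < key (σ u)

/-- The probability that `x` is selected from a uniformly random arrival order. -/
noncomputable def selectProb (n : ℕ) (key : G → L) (s : ℕ) (x : G) : ℝ :=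
  countOrders (fun σ : Fin n ≃ G => Selects key s σ x) / Nat.factorial n

theorem selectProb_nonneg (key : G → L) (s : ℕ) (x : G) : 0 ≤ selectProb n key s x :=
  div_nonneg (countOrders_nonneg _) (by positivity)

/-- With an empty sample the first arrival is vacuously better than the sample and is taken. This is
the situation for groups of size one and two. -/
theorem selectProb_zero (hn : Fintype.card G = n) (hpos : 0 < n) (key : G → L) (x : G) :
    selectProb n key 0 x = 1 / n := by
  have h := countOrders_one hn x ⟨0, hpos⟩
  have e : countOrders (fun σ : Fin n ≃ G => Selects key 0 σ x)
      = countOrders (fun σ : Fin n ≃ G => σ ⟨0, hpos⟩ = x) := by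
    refine countOrders_congr fun σ => ?_
    constructor
    · rintro ⟨t, -, ht, -, h2⟩
      by_cases h0 : t = ⟨0, hpos⟩
      · rwa [h0] at ht
      · exfalso
        refine h2 ⟨0, hpos⟩ (Nat.zero_le _) ?_ (by simp)
        rw [Fin.lt_def]
        have : (t : ℕ) ≠ 0 := fun h => h0 (Fin.ext h)
        simpa using Nat.pos_of_ne_zero this
    · intro h
      refine ⟨⟨0, hpos⟩, Nat.zero_le _, h, by simp, ?_⟩
      intro u _ hu
      exact absurd hu (by simp [Fin.lt_def])
  have hf : (0 : ℝ) < Nat.factorial n := by exact_mod_cast Nat.factorial_pos n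
  have hn' : (0 : ℝ) < n := by exact_mod_cast hpos
  rw [selectProb, e]
  field_simp
  linarith

theorem sum_fin_filter_le (s : ℕ) (g : ℕ → ℝ) :
    ∑ t ∈ Finset.univ.filter (fun t : Fin n => s ≤ (t : ℕ)), g t = ∑ t ∈ Finset.Ico s n, g t := by
  refine Finset.sum_bij (fun t _ => (t : ℕ)) ?_ ?_ ?_ ?_
  · intro t ht
    simp only [Finset.mem_filter, Finset.mem_univ, true_and] at ht
    exact Finset.mem_Ico.mpr ⟨ht, t.2⟩
  · intro a _ b _ h
    exact Fin.ext h
  · intro b hb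
    rw [Finset.mem_Ico] at hb
    exact ⟨⟨b, hb.2⟩, by simpa using hb.1, rfl⟩
  · intro _ _
    rfl

variable {key : G → L}

/-- If `x` stands at position `t`, everything better comes later, and the best of the first `t`
arrivals lies in the sample, then `x` is selected. The last condition has probability `s / t`
independently of the first two, because those are unaffected by permuting the first `t` positions.
The function `g` is any lower bound for the probability of the first two. -/
theorem selectProb_ge_sum (hkey : Function.Injective key) {s : ℕ} (hs : 0 < s) (x : G)
    (g : ℕ → ℝ)
    (hg : ∀ t : Fin n, s ≤ (t : ℕ) → g t * Nat.factorial n ≤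
      countOrders (fun σ : Fin n ≃ G => σ t = x ∧ ∀ y, key x < key y → t < σ.symm y)) :
    ∑ t ∈ Finset.Ico s n, (s : ℝ) / t * g t ≤ selectProb n key s x := by
  have hf : (0 : ℝ) < Nat.factorial n := by exact_mod_cast Nat.factorial_pos n
  rw [selectProb, le_div_iff₀ hf, ← sum_fin_filter_le (n := n), Finset.sum_mul]
  have hsub : countOrders (fun σ : Fin n ≃ G => True ∧
      ∃ t ∈ Finset.univ.filter (fun t : Fin n => s ≤ (t : ℕ)),
        ((σ t = x ∧ ∀ y, key x < key y → t < σ.symm y) ∧ ∃ m : Fin n, (m : ℕ) < s ∧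
        ∀ i : Fin n, (i : ℕ) < t → key (σ i) ≤ key (σ m)))
      ≤ countOrders (fun σ : Fin n ≃ G => Selects key s σ x) := by
    refine countOrders_mono ?_
    rintro σ ⟨-, t, ht, ⟨hx, hlater⟩, m, hm, hmax⟩
    simp only [Finset.mem_filter, Finset.mem_univ, true_and] at ht
    refine ⟨t, ht, hx, ?_, ?_⟩
    · intro i hi
      rcases lt_trichotomy (key (σ i)) (key x) with h | h | h
      · exact h
      · exfalso
        have : i = t := σ.injective ((hkey h).trans hx.symm)
        omega
      · exfalso
        have := hlater _ h
        rw [Equiv.symm_apply_apply, Fin.lt_def] at this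
        omega
    · intro u _ hut hall
      exact absurd (hall m hm) (not_lt.mpr (hmax u hut))
  refine le_trans ?_ hsub
  rw [countOrders_biUnion]
  · refine Finset.sum_le_sum fun t ht => ?_
    simp only [Finset.mem_filter, Finset.mem_univ, true_and] at ht
    have hpos : 0 < (t : ℕ) := lt_of_lt_of_le hs ht
    have hpos' : (0 : ℝ) < (t : ℕ) := by exact_mod_cast hpos
    have h := countOrders_argmax hkey ht hpos t.2.le
      (fun σ : Fin n ≃ G => σ t = x ∧ ∀ y, key x < key y → t < σ.symm y)
      (by
        rintro a b ha hb σ ⟨h1, h2⟩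
        have hat : t ≠ a := fun h => by rw [← h] at ha; exact lt_irrefl _ ha
        have hbt : t ≠ b := fun h => by rw [← h] at hb; exact lt_irrefl _ hb
        refine ⟨by simp [Equiv.swap_apply_of_ne_of_ne hat hbt, h1], ?_⟩
        intro y hy
        have h3 := h2 y hy
        rw [Fin.lt_def] at h3
        have : Equiv.swap a b (σ.symm y) = σ.symm y := by
          apply Equiv.swap_apply_of_ne_of_ne
          · rintro h; rw [h] at h3; omega
          · rintro h; rw [h] at h3; omega
        simp only [Equiv.symm_trans_apply, Equiv.symm_swap, this]
        exact h2 y hy)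
    simp only [true_and]
    have h4 := hg t ht
    have h5 : (s : ℝ) / (t : ℕ) * g t * Nat.factorial n
        ≤ (s : ℝ) / (t : ℕ) * countOrders
          (fun σ : Fin n ≃ G => σ t = x ∧ ∀ y, key x < key y → t < σ.symm y) := by
      rw [mul_assoc]
      exact mul_le_mul_of_nonneg_left h4 (by positivity)
    refine h5.trans (le_of_eq ?_)
    rw [div_mul_eq_mul_div, ← h]
    field_simp
  · rintro σ - i _ j _ ⟨⟨hi, -⟩, -⟩ ⟨⟨hj, -⟩, -⟩
    exact σ.injective (hi.trans hj.symm)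

/-- Selection of `x` at `t` forces the best of the first `t` arrivals into the sample. Dropping the
condition that `x` beats the sample leaves the value attained by the best element. -/
theorem selectProb_le_sum (hn : Fintype.card G = n) (hkey : Function.Injective key) {s : ℕ}
    (hs : 0 < s) (x : G) :
    selectProb n key s x ≤ ∑ t ∈ Finset.Ico s n, (s : ℝ) / t * (1 / n) := by
  have hf : (0 : ℝ) < Nat.factorial n := by exact_mod_cast Nat.factorial_pos n
  rw [selectProb, div_le_iff₀ hf, ← sum_fin_filter_le (n := n), Finset.sum_mul]
  have hsub : countOrders (fun σ : Fin n ≃ G => Selects key s σ x)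
      ≤ countOrders (fun σ : Fin n ≃ G => True ∧
      ∃ t ∈ Finset.univ.filter (fun t : Fin n => s ≤ (t : ℕ)),
        (σ t = x ∧ ∃ m : Fin n, (m : ℕ) < s ∧
        ∀ i : Fin n, (i : ℕ) < t → key (σ i) ≤ key (σ m))) := by
    refine countOrders_mono ?_
    rintro σ ⟨t, ht, hx, h1, h2⟩
    refine ⟨trivial, t, by simpa using ht, hx, ?_⟩
    have htn := t.2
    obtain ⟨m, hm, hmax⟩ := Finset.exists_max_image
      (Finset.univ.filter (fun i : Fin n => (i : ℕ) < s)) (fun i => key (σ i))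
      ⟨⟨0, by omega⟩, by simpa using hs⟩
    simp only [Finset.mem_filter, Finset.mem_univ, true_and] at hm hmax
    refine ⟨m, hm, fun i hi => ?_⟩
    by_cases his : (i : ℕ) < s
    · exact hmax i his
    · have := h2 i (by omega) hi
      push Not at this
      obtain ⟨k, hk, hle⟩ := this
      exact hle.trans (hmax k hk)
  refine hsub.trans ?_
  rw [countOrders_biUnion]
  · refine Finset.sum_le_sum fun t ht => ?_
    simp only [Finset.mem_filter, Finset.mem_univ, true_and] at ht
    have hpos : 0 < (t : ℕ) := lt_of_lt_of_le hs ht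
    have hpos' : (0 : ℝ) < (t : ℕ) := by exact_mod_cast hpos
    have hn' : (0 : ℝ) < n := by
      have := t.2
      exact_mod_cast (by omega : 0 < n)
    have h := countOrders_argmax hkey ht hpos t.2.le
      (fun σ : Fin n ≃ G => σ t = x)
      (by
        intro a b ha hb σ h1
        have hat : t ≠ a := fun h => by rw [← h] at ha; exact lt_irrefl _ ha
        have hbt : t ≠ b := fun h => by rw [← h] at hb; exact lt_irrefl _ hb
        simp [Equiv.swap_apply_of_ne_of_ne hat hbt, h1])
    simp only [true_and]
    refine le_of_eq ?_
    rw [← countOrders_one hn x t, ← mul_left_cancel_iff_of_pos hpos', h]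
    field_simp
  · rintro σ - i _ j _ ⟨hi, -⟩ ⟨hj, -⟩
    exact σ.injective (hi.trans hj.symm)

theorem selectProb_first (hn : Fintype.card G = n) (hkey : Function.Injective key) {s : ℕ}
    (hs : 0 < s) (x : G) (hx : ∀ y, key y ≤ key x) :
    ∑ t ∈ Finset.Ico s n, (s : ℝ) / t * (1 / n) ≤ selectProb n key s x := by
  refine selectProb_ge_sum hkey hs x (fun _ => 1 / n) fun t _ => ?_
  have hn' : (0 : ℝ) < n := by
    have := t.2
    exact_mod_cast (by omega : 0 < n)
  have h := countOrders_one hn x t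
  have e : countOrders (fun σ : Fin n ≃ G => σ t = x ∧ ∀ y, key x < key y → t < σ.symm y)
      = countOrders (fun σ : Fin n ≃ G => σ t = x) :=
    countOrders_congr fun σ => ⟨fun h => h.1, fun h => ⟨h, fun y hy => absurd hy (not_lt.mpr (hx y))⟩⟩
  rw [e, ← h]
  field_simp
  exact le_rfl

theorem selectProb_second (hn : Fintype.card G = n) (hkey : Function.Injective key) {s : ℕ}
    (hs : 0 < s) {x y : G} (hxy : x ≠ y) (hx : ∀ z, z ≠ y → key z ≤ key x) :
    ∑ t ∈ Finset.Ico s n, (s : ℝ) / t * (((n : ℝ) - 1 - t) / (n * ((n : ℝ) - 1)))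
      ≤ selectProb n key s x := by
  refine selectProb_ge_sum hkey hs x (fun t => ((n : ℝ) - 1 - t) / (n * ((n : ℝ) - 1)))
    fun t _ => ?_
  have hn2 : 2 ≤ n := by
    rw [← hn]
    exact Fintype.one_lt_card_iff.mpr ⟨x, y, hxy⟩
  have hn' : (2 : ℝ) ≤ n := by exact_mod_cast hn2
  have h1 := countOrders_one hn x t
  have h2 := countOrders_two (n := n) hxy t
  have hle : countOrders (fun σ : Fin n ≃ G => σ t = x ∧ t < σ.symm y)
      ≤ countOrders (fun σ : Fin n ≃ G => σ t = x ∧ ∀ y, key x < key y → t < σ.symm y) :=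
    countOrders_mono fun σ h => ⟨h.1, fun z hz => by
      by_cases hzy : z = y
      · rw [hzy]; exact h.2
      · exact absurd hz (not_lt.mpr (hx z hzy))⟩
  refine le_trans (le_of_eq ?_) hle
  have hn1 : (0 : ℝ) < (n : ℝ) - 1 := by linarith
  rw [← mul_left_cancel_iff_of_pos hn1, h2, ← h1]
  have : (n : ℝ) - 1 ≠ 0 := hn1.ne'
  field_simp

theorem selectProb_third (hn : Fintype.card G = n) (hkey : Function.Injective key) {s : ℕ}
    (hs : 0 < s) {x y z : G} (hxy : x ≠ y) (hxz : x ≠ z) (hyz : y ≠ z)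
    (hx : ∀ w, w ≠ y → w ≠ z → key w ≤ key x) :
    ∑ t ∈ Finset.Ico s n, (s : ℝ) / t *
        (((n : ℝ) - 1 - t) * ((n : ℝ) - 2 - t) / (n * ((n : ℝ) - 1) * ((n : ℝ) - 2)))
      ≤ selectProb n key s x := by
  refine selectProb_ge_sum hkey hs x
    (fun t => ((n : ℝ) - 1 - t) * ((n : ℝ) - 2 - t) / (n * ((n : ℝ) - 1) * ((n : ℝ) - 2)))
    fun t _ => ?_
  have hn3 : 3 ≤ n := by
    rw [← hn]
    exact Fintype.two_lt_card_iff.mpr ⟨x, y, z, hxy, hxz, hyz⟩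
  have hn' : (3 : ℝ) ≤ n := by exact_mod_cast hn3
  have h1 := countOrders_one hn x t
  have h2 := countOrders_two (n := n) hxy t
  have h3 := countOrders_three (n := n) hxy hxz hyz t
  have hle : countOrders (fun σ : Fin n ≃ G => σ t = x ∧ t < σ.symm y ∧ t < σ.symm z)
      ≤ countOrders (fun σ : Fin n ≃ G => σ t = x ∧ ∀ y, key x < key y → t < σ.symm y) :=
    countOrders_mono fun σ h => ⟨h.1, fun w hw => by
      by_cases hwy : w = y
      · rw [hwy]; exact h.2.1
      · by_cases hwz : w = z
        · rw [hwz]; exact h.2.2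
        · exact absurd hw (not_lt.mpr (hx w hwy hwz))⟩
  refine le_trans (le_of_eq ?_) hle
  have hn1 : (0 : ℝ) < (n : ℝ) - 1 := by linarith
  have hn2 : (0 : ℝ) < (n : ℝ) - 2 := by linarith
  have hn1' := hn1.ne'
  have hn2' := hn2.ne'
  rw [← mul_left_cancel_iff_of_pos hn2, h3, ← mul_left_cancel_iff_of_pos hn1,
    mul_left_comm ((n : ℝ) - 1) ((n : ℝ) - 2 - t), h2, ← h1]
  field_simp

end Selection

/-! ### From the list formulation of Dynkin's algorithm to arrival orders. -/

section Dynkin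

variable {α : Type*}

/-- Values with the tie-breaking rule as a single key. -/
def rankKey (v : α → ℝ) (x : α) : ℝ ×ₗ α := toLex (v x, x)

theorem rankKey_injective (v : α → ℝ) : Function.Injective (rankKey v) := by
  intro x y h
  have := congrArg (fun p => (ofLex p).2) h
  simpa [rankKey] using this

theorem beats_iff [LinearOrder α] (v : α → ℝ) (x y : α) : Beats v x y ↔ rankKey v y < rankKey v x := by
  simp [Beats, rankKey, Prod.Lex.toLex_lt_toLex]

theorem dynkin_ofFn_eq_some_iff [LinearOrder α] (v : α → ℝ) {n : ℕ} {G : Type*} [Fintype G] (ι : G → α)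
    (hι : Function.Injective ι) (σ : Fin n ≃ G) (x : G) :
    dynkin v (List.ofFn (fun i => ι (σ i))) = some (ι x)
      ↔ Selects (fun y => rankKey v (ι y)) ⌊(n : ℝ) / Real.exp 1⌋₊ σ x := by
  have hall : ∀ (s : ℕ) (z : α), (decide (∀ y ∈ (List.ofFn (fun i => ι (σ i))).take s, Beats v z y) = true)
      ↔ ∀ i : Fin n, (i : ℕ) < s → rankKey v (ι (σ i)) < rankKey v z := by
    intro s z
    rw [decide_eq_true_iff]
    constructor
    · intro h i hi
      rw [← beats_iff]
      apply h
      rw [List.mem_take_iff_getElem]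
      exact ⟨i, by simp [hi], by simp⟩
    · intro h y hy
      rw [List.mem_take_iff_getElem] at hy
      obtain ⟨i, hi, rfl⟩ := hy
      simp only [List.length_ofFn, lt_min_iff] at hi
      rw [beats_iff]
      simpa using h ⟨i, hi.2⟩ hi.1
  simp only [dynkin, List.length_ofFn]
  generalize ⌊(n : ℝ) / Real.exp 1⌋₊ = s
  rw [List.find?_eq_some_iff_getElem, hall]
  constructor
  · rintro ⟨h1, i, hi, hix, h2⟩
    simp only [List.length_drop, List.length_ofFn] at hi
    simp only [List.getElem_drop, List.getElem_ofFn] at hix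
    refine ⟨⟨s + i, by omega⟩, by simp, hι hix, h1, ?_⟩
    intro u hsu hui hu
    have hui' : (u : ℕ) < s + i := hui
    have := h2 (u - s) (by omega)
    rw [Bool.not_eq_true', ← Bool.not_eq_true, hall] at this
    apply this
    simp only [List.getElem_drop, List.getElem_ofFn]
    have e : (⟨s + ((u : ℕ) - s), by omega⟩ : Fin n) = u := Fin.ext (by simp; omega)
    rw [e]
    exact hu
  · rintro ⟨t, ht, hx, h1, h2⟩
    refine ⟨h1, t - s, by simp; omega, ?_, ?_⟩
    · simp only [List.getElem_drop, List.getElem_ofFn]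
      rw [← hx]
      congr 2
      exact Fin.ext (by simp; omega)
    · intro j hj
      rw [Bool.not_eq_true', ← Bool.not_eq_true, hall]
      simp only [List.getElem_drop, List.getElem_ofFn]
      exact h2 ⟨s + j, by omega⟩ (by simp) (by rw [Fin.lt_def]; simp; omega)

end Dynkin

/-! ### Numerical bounds for the selection probabilities. -/

/-- The trapezoidal rule overestimates the integral of the convex function `1 / t`. The correction
term is needed: without it the bounds for moderate `n` would be too weak. -/
theorem log_ratio_le_sum {s n : ℕ} (hs : 0 < s) (hsn : s ≤ n) :
    Real.log (n / s) + ((1 : ℝ) / s - 1 / n) / 2 ≤ ∑ t ∈ Finset.Ico s n, (1 : ℝ) / t := by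
  have hs' : (0 : ℝ) < s := by exact_mod_cast hs
  induction n, hsn using Nat.le_induction with
  | base => simp [hs'.ne']
  | succ n hn ih =>
    have hn' : (0 : ℝ) < n := by exact_mod_cast lt_of_lt_of_le hs hn
    rw [Finset.sum_Ico_succ_top hn]
    have hy : 0 ≤ Real.log ((n + 1) / n) :=
      Real.log_nonneg (by rw [le_div_iff₀ hn']; linarith)
    -- `y ≤ sinh y` at `y = log ((n + 1) / n)` is the one-step trapezoidal bound `log ((n + 1) / n)
    -- ≤ (1 / n + 1 / (n + 1)) / 2`.
    have h := Real.self_le_sinh_iff.mpr hy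
    rw [Real.sinh_eq, Real.exp_neg, Real.exp_log (by positivity)] at h
    have e1 : Real.log (((n + 1 : ℕ) : ℝ) / s) = Real.log (n / s) + Real.log ((n + 1) / n) := by
      rw [← Real.log_mul (by positivity) (by positivity)]
      congr 1
      push_cast
      field_simp
    rw [e1]
    have e2 : (((n : ℝ) + 1) / n - (((n : ℝ) + 1) / n)⁻¹) / 2
        = 1 / n - (1 / (n : ℝ) - 1 / ((n + 1 : ℕ) : ℝ)) / 2 := by
      push_cast
      field_simp
      ring
    rw [e2] at h
    linarith

theorem sum_le_log_ratio {s n : ℕ} (hs : 0 < s) (hsn : s ≤ n) :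
    ∑ t ∈ Finset.Ico s (n + 1), (1 : ℝ) / t ≤ 1 / s + Real.log (n / s) := by
  have hs' : (0 : ℝ) < s := by exact_mod_cast hs
  induction n, hsn using Nat.le_induction with
  | base => simp [hs'.ne']
  | succ n hn ih =>
    have hn' : (0 : ℝ) < n := by exact_mod_cast lt_of_lt_of_le hs hn
    rw [Finset.sum_Ico_succ_top (by omega)]
    have e1 : Real.log (((n + 1 : ℕ) : ℝ) / s) = Real.log (n / s) + Real.log ((n + 1) / n) := by
      rw [← Real.log_mul (by positivity) (by positivity)]
      congr 1
      push_cast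
      field_simp
    have h := Real.one_sub_inv_le_log_of_pos (show (0 : ℝ) < ((n : ℝ) + 1) / n by positivity)
    have e2 : 1 - (((n : ℝ) + 1) / n)⁻¹ = 1 / ((n + 1 : ℕ) : ℝ) := by
      push_cast
      field_simp
      ring
    rw [e2] at h
    linarith

/-- The sum of the reciprocals in the success probabilities, with the sample size `s`. -/
noncomputable def recipSum (s n : ℕ) : ℝ := ∑ t ∈ Finset.Ico s n, (1 : ℝ) / t

theorem sum_first (s n : ℕ) :
    ∑ t ∈ Finset.Ico s n, (s : ℝ) / t * (1 / n) = s / n * recipSum s n := by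
  rw [recipSum, Finset.mul_sum]
  refine Finset.sum_congr rfl fun t _ => ?_
  ring

theorem sum_second {s n : ℕ} (hs : 0 < s) (hsn : s ≤ n) :
    ∑ t ∈ Finset.Ico s n, (s : ℝ) / t * (((n : ℝ) - 1 - t) / (n * ((n : ℝ) - 1)))
      = s / (n * ((n : ℝ) - 1)) * (((n : ℝ) - 1) * recipSum s n - (n - s)) := by
  have h1 : ∑ t ∈ Finset.Ico s n, (1 : ℝ) = n - s := by
    simp [Nat.cast_sub hsn]
  rw [recipSum, ← h1, Finset.mul_sum, ← Finset.sum_sub_distrib, Finset.mul_sum]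
  refine Finset.sum_congr rfl fun t ht => ?_
  rw [Finset.mem_Ico] at ht
  have ht' : (t : ℝ) ≠ 0 := by
    have : 0 < t := by omega
    positivity
  rw [show ((n : ℝ) - 1) * (1 / t) - 1 = ((n : ℝ) - 1 - t) / t by field_simp]
  ring

theorem sum_third {s n : ℕ} (hs : 0 < s) (hsn : s ≤ n) :
    ∑ t ∈ Finset.Ico s n, (s : ℝ) / t *
        (((n : ℝ) - 1 - t) * ((n : ℝ) - 2 - t) / (n * ((n : ℝ) - 1) * ((n : ℝ) - 2)))
      = s / (n * ((n : ℝ) - 1) * ((n : ℝ) - 2)) *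
        (((n : ℝ) - 1) * ((n : ℝ) - 2) * recipSum s n - (2 * n - 3) * (n - s)
          + (n * (n - 1) - s * (s - 1)) / 2) := by
  have h1 : ∑ t ∈ Finset.Ico s n, (1 : ℝ) = n - s := by
    simp [Nat.cast_sub hsn]
  have h2 : ∑ t ∈ Finset.Ico s n, (t : ℝ) = (n * (n - 1) - s * (s - 1)) / 2 := by
    clear h1
    induction n, hsn using Nat.le_induction with
    | base => simp
    | succ n hn ih =>
      rw [Finset.sum_Ico_succ_top hn, ih]
      push_cast
      ring
  rw [recipSum, ← h1, ← h2, Finset.mul_sum, Finset.mul_sum, ← Finset.sum_sub_distrib,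
    ← Finset.sum_add_distrib, Finset.mul_sum]
  refine Finset.sum_congr rfl fun t ht => ?_
  rw [Finset.mem_Ico] at ht
  have ht' : (t : ℝ) ≠ 0 := by
    have : 0 < t := by omega
    positivity
  rw [show ((n : ℝ) - 1) * ((n : ℝ) - 2) * (1 / t) - (2 * n - 3) * 1 + t
    = ((n : ℝ) - 1 - t) * ((n : ℝ) - 2 - t) / t by field_simp; ring]
  ring

theorem sample_pos {n : ℕ} (hn : 3 ≤ n) : 0 < ⌊(n : ℝ) / Real.exp 1⌋₊ := by
  rw [Nat.floor_pos, le_div_iff₀ (Real.exp_pos 1)]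
  have := Real.exp_one_lt_d9
  have : (3 : ℝ) ≤ n := by exact_mod_cast hn
  linarith

theorem sample_le (n : ℕ) : ((⌊(n : ℝ) / Real.exp 1⌋₊ : ℕ) : ℝ) * Real.exp 1 ≤ n := by
  rw [← le_div_iff₀ (Real.exp_pos 1)]
  exact Nat.floor_le (by positivity)

theorem lt_sample_add_one (n : ℕ) :
    (n : ℝ) < (((⌊(n : ℝ) / Real.exp 1⌋₊ : ℕ) : ℝ) + 1) * Real.exp 1 := by
  rw [← div_lt_iff₀ (Real.exp_pos 1)]
  exact Nat.lt_floor_add_one _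

theorem sample_lt {n : ℕ} (hn : 0 < n) : ⌊(n : ℝ) / Real.exp 1⌋₊ < n := by
  have h := sample_le n
  have h1 := Real.exp_one_gt_d9
  have h2 : (0 : ℝ) < n := by exact_mod_cast hn
  have : ((⌊(n : ℝ) / Real.exp 1⌋₊ : ℕ) : ℝ) < n := by
    by_contra hc
    push Not at hc
    nlinarith
  exact_mod_cast this

/-- The lower bounds on the success probabilities in terms of `x = s / n` and `w = 1 / n`. -/
theorem weighted_bounds_aux {x w p₁ p₂ p₃ : ℝ} (hw0 : 0 < w) (hw : w ≤ 1 / 20)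
    (hx1 : 0.367879 - w ≤ x) (hx2 : x ≤ 0.36788)
    (h1 : x * (2 - 2.71829 * x) + (1 - x) * w / 2 ≤ p₁)
    (h2 : p₁ - x * (1 - x) * (1 + 1.053 * w) ≤ p₂)
    (h3 : p₁ - x * (1 - x) * ((3 - x) / 2 + 1.77 * w) ≤ p₃) :
    4 ≤ 10.98 * p₁ ∧ 4 ≤ 7.12 * p₁ + 10.98 * p₂ ∧ 4 ≤ 7.12 * (p₁ + p₂ + p₃) := by
  have hx0 : 0.317 ≤ x := by linarith
  refine ⟨?_, ?_, ?_⟩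
  · nlinarith [mul_nonneg (sub_nonneg.mpr hx0) (sub_nonneg.mpr hx2)]
  · have : 0 ≤ (w - (0.367879 - x)) := by linarith
    nlinarith [mul_nonneg (sub_nonneg.mpr hx0) (sub_nonneg.mpr hx2), mul_nonneg this (sub_nonneg.mpr hx2),
      mul_nonneg hw0.le (sub_nonneg.mpr hx2), mul_nonneg hw0.le (sub_nonneg.mpr hx0)]
  · have : 0 ≤ (w - (0.367879 - x)) := by linarith
    nlinarith [mul_nonneg (sub_nonneg.mpr hx0) (sub_nonneg.mpr hx2), mul_nonneg this (sub_nonneg.mpr hx2),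
      mul_nonneg hw0.le (sub_nonneg.mpr hx2), mul_nonneg hw0.le (sub_nonneg.mpr hx0),
      mul_nonneg (mul_nonneg (sub_nonneg.mpr hx0) (sub_nonneg.mpr hx2)) (sub_nonneg.mpr hx2)]

theorem weighted_bounds_large {n s : ℕ} (hn : 20 ≤ n) (h1 : (s : ℝ) * Real.exp 1 ≤ n)
    (h2 : (n : ℝ) < (s + 1) * Real.exp 1) (hs : 0 < s) (hsn : s ≤ n) {p₁ p₂ p₃ : ℝ}
    (hp₁ : p₁ = s / n * recipSum s n)
    (hp₂ : p₂ = s / (n * ((n : ℝ) - 1)) * (((n : ℝ) - 1) * recipSum s n - (n - s)))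
    (hp₃ : p₃ = s / (n * ((n : ℝ) - 1) * ((n : ℝ) - 2)) *
        (((n : ℝ) - 1) * ((n : ℝ) - 2) * recipSum s n - (2 * n - 3) * (n - s)
          + (n * (n - 1) - s * (s - 1)) / 2)) :
    4 ≤ 10.98 * p₁ ∧ 4 ≤ 7.12 * p₁ + 10.98 * p₂ ∧ 4 ≤ 7.12 * (p₁ + p₂ + p₃) := by
  have hn' : (20 : ℝ) ≤ n := by exact_mod_cast hn
  have hn0 : (0 : ℝ) < n := by linarith
  have hs' : (0 : ℝ) < s := by exact_mod_cast hs
  have hegt := Real.exp_one_gt_d9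
  have helt := Real.exp_one_lt_d9
  set e := Real.exp 1 with he
  obtain ⟨w, hwdef⟩ : ∃ w : ℝ, w = 1 / n := ⟨_, rfl⟩
  obtain ⟨x, hxdef⟩ : ∃ x : ℝ, x = s / n := ⟨_, rfl⟩
  have hsx : (s : ℝ) = x * n := by rw [hxdef]; field_simp
  have hnw : (n : ℝ) = 1 / w := by rw [hwdef]; field_simp
  have hw0 : 0 < w := by rw [hwdef]; positivity
  have hw : w ≤ 1 / 20 := by
    rw [hwdef]
    exact one_div_le_one_div_of_le (by norm_num) hn'
  have hwn : w * n = 1 := by rw [hwdef]; field_simp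
  have hx0 : 0 < x := by rw [hxdef]; positivity
  have hxe : x * e ≤ 1 := by
    rw [hxdef, div_mul_eq_mul_div, div_le_one hn0]
    exact h1
  have hxe2 : 1 < (x + w) * e := by
    have : (x + w) * e * n = (s + 1) * e := by rw [hsx]; linear_combination e * hwn
    nlinarith
  have hx2 : x ≤ 0.36788 := by nlinarith
  have hx1 : 0.367879 - w ≤ x := by nlinarith
  -- With `x = s / n`, this is the tangent of `-log x` at `1 / e`, near which the sample fraction
  -- lies.
  have hlog : 2 - e * x ≤ Real.log (n / s) := by
    have h := Real.one_sub_inv_le_log_of_pos (show (0 : ℝ) < n / (e * s) by positivity)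
    have h3 : Real.log (n / (e * s)) = Real.log (n / s) - 1 := by
      rw [mul_comm, ← div_div, Real.log_div (by positivity) (by positivity), he, Real.log_exp]
    rw [h3, inv_div] at h
    have : e * s / n = e * x := by rw [hxdef]; ring
    linarith
  have hrec := log_ratio_le_sum hs hsn
  rw [← recipSum] at hrec
  refine weighted_bounds_aux hw0 hw hx1 hx2 ?_ ?_ ?_
  · have h3 : x * (2 - e * x + ((1 : ℝ) / s - 1 / n) / 2) ≤ p₁ := by
      rw [hp₁, ← hxdef]
      exact mul_le_mul_of_nonneg_left (by linarith) hx0.le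
    have h4 : x * (((1 : ℝ) / s - 1 / n) / 2) = (1 - x) * w / 2 := by
      rw [hxdef, hwdef]
      field_simp
    have h5 : x * (2 - 2.71829 * x) ≤ x * (2 - e * x) := by
      apply mul_le_mul_of_nonneg_left _ hx0.le
      have := mul_le_mul_of_nonneg_right (show e ≤ 2.71829 by linarith) hx0.le
      linarith
    rw [mul_add, h4] at h3
    linarith
  · have h3 : p₂ = p₁ - x * (1 - x) / (1 - w) := by
      have : (n : ℝ) - 1 ≠ 0 := by linarith
      have h5 : (1 : ℝ) - w ≠ 0 := by linarith
      have h6 : (n : ℝ) - 1 = n * (1 - w) := by linear_combination hwn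
      rw [hp₂, hp₁, h6, hsx]
      field_simp
    -- Since `w ≤ 1 / 20`, the exact factor is at most `20 / 19 < 1.053`.
    have h4 : 1 / (1 - w) ≤ 1 + 1.053 * w := by
      rw [div_le_iff₀ (by linarith)]
      nlinarith
    have h5 : 0 ≤ x * (1 - x) := mul_nonneg hx0.le (by linarith)
    have := mul_le_mul_of_nonneg_left h4 h5
    rw [h3, div_eq_mul_one_div]
    linarith
  · have h3 : p₃ = p₁ - x * (1 - x) * ((3 - x - 5 * w) / (2 * (1 - w) * (1 - 2 * w))) := by
      have h5 : (1 : ℝ) - w ≠ 0 := by linarith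
      have h6 : (n : ℝ) - 1 = n * (1 - w) := by linear_combination hwn
      have h7 : (1 : ℝ) - w * 2 ≠ 0 := by linarith
      have h8 : (n : ℝ) - 2 = n * (1 - w * 2) := by linear_combination 2 * hwn
      have h9 : (2 * (n : ℝ) - 3) * (n - s) - (n * (n - 1) - s * (s - 1)) / 2
          = n ^ 2 * ((1 - x) * (3 - x - 5 * w) / 2) := by
        rw [hsx]
        linear_combination (n : ℝ) * (1 - x) * (5 / 2) * hwn
      rw [hp₃, hp₁, show ((n : ℝ) - 1) * ((n : ℝ) - 2) * recipSum s n - (2 * n - 3) * (n - s)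
          + (n * (n - 1) - s * (s - 1)) / 2 = ((n : ℝ) - 1) * ((n : ℝ) - 2) * recipSum s n -
          n ^ 2 * ((1 - x) * (3 - x - 5 * w) / 2) by rw [← h9]; ring, h6, h8, hsx]
      field_simp
    have hx3 : 0.317 ≤ x := by linarith
    have h4 : (3 - x - 5 * w) / (2 * (1 - w) * (1 - 2 * w)) ≤ (3 - x) / 2 + 1.77 * w := by
      have hd : 0 < 2 * (1 - w) * (1 - 2 * w) :=
        mul_pos (mul_pos two_pos (by linarith)) (by linarith)
      rw [div_le_iff₀ hd]
      have h10 : 0 ≤ w * (-0.46 + 3 * x - 4.62 * w - 2 * (x * w)) := by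
        apply mul_nonneg hw0.le
        have := mul_le_mul_of_nonneg_left hw hx0.le
        linarith
      have h11 : ((3 - x) / 2 + 1.77 * w) * (2 * (1 - w) * (1 - 2 * w)) - (3 - x - 5 * w)
          = w * (-0.46 + 3 * x - 4.62 * w - 2 * (x * w)) + 7.08 * w ^ 3 := by ring
      have h12 := pow_pos hw0 3
      linarith
    have h5 : 0 ≤ x * (1 - x) := mul_nonneg hx0.le (by linarith)
    have := mul_le_mul_of_nonneg_left h4 h5
    rw [h3]
    linarith

theorem weighted_bounds_small {n s : ℕ} (hn3 : 3 ≤ n) (hn : n < 20)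
    (h1 : (s : ℝ) * Real.exp 1 ≤ n)
    (h2 : (n : ℝ) < (s + 1) * Real.exp 1) {p₁ p₂ p₃ : ℝ}
    (hp₁ : p₁ = s / n * recipSum s n)
    (hp₂ : p₂ = s / (n * ((n : ℝ) - 1)) * (((n : ℝ) - 1) * recipSum s n - (n - s)))
    (hp₃ : p₃ = s / (n * ((n : ℝ) - 1) * ((n : ℝ) - 2)) *
        (((n : ℝ) - 1) * ((n : ℝ) - 2) * recipSum s n - (2 * n - 3) * (n - s)
          + (n * (n - 1) - s * (s - 1)) / 2)) :
    4 ≤ 10.98 * p₁ ∧ 4 ≤ 7.12 * p₁ + 10.98 * p₂ ∧ 4 ≤ 7.12 * (p₁ + p₂ + p₃) := by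
  have hegt := Real.exp_one_gt_d9
  have helt := Real.exp_one_lt_d9
  have h1' : (s : ℝ) * 2.718 ≤ n := by nlinarith [(Nat.cast_nonneg s : (0 : ℝ) ≤ s)]
  have h2' : (n : ℝ) < (s + 1) * 2.719 := by nlinarith [(Nat.cast_nonneg s : (0 : ℝ) ≤ s)]
  have h3 : s * 2718 ≤ n * 1000 := by
    have : (s : ℝ) * 2718 ≤ n * 1000 := by linarith
    exact_mod_cast this
  have h4 : n * 1000 < (s + 1) * 2719 := by
    have : (n : ℝ) * 1000 < (s + 1) * 2719 := by linarith
    exact_mod_cast this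
  rw [hp₁, hp₂, hp₃]
  clear h1 h2 h1' h2' hp₁ hp₂ hp₃ hegt helt
  unfold recipSum
  have hs1 : 0 < s := by omega
  have hs7 : s < 7 := by omega
  -- The integer inequalities, obtained from `2.718 < e < 2.719`, discard every pair that is not a
  -- group size with its sample size; the rest is rational arithmetic.
  interval_cases s <;> interval_cases n <;> first
    | omega
    | norm_num [Finset.sum_Ico_eq_sum_range, Finset.sum_range_succ]

theorem weighted_bounds {n s : ℕ} (hn : 3 ≤ n) (hs : s = ⌊(n : ℝ) / Real.exp 1⌋₊) {p₁ p₂ p₃ : ℝ}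
    (hp₁ : p₁ = s / n * recipSum s n)
    (hp₂ : p₂ = s / (n * ((n : ℝ) - 1)) * (((n : ℝ) - 1) * recipSum s n - (n - s)))
    (hp₃ : p₃ = s / (n * ((n : ℝ) - 1) * ((n : ℝ) - 2)) *
        (((n : ℝ) - 1) * ((n : ℝ) - 2) * recipSum s n - (2 * n - 3) * (n - s)
          + (n * (n - 1) - s * (s - 1)) / 2)) :
    4 ≤ 10.98 * p₁ ∧ 4 ≤ 7.12 * p₁ + 10.98 * p₂ ∧ 4 ≤ 7.12 * (p₁ + p₂ + p₃) := by
  have h1 := sample_le n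
  have h2 := lt_sample_add_one n
  have h3 := sample_pos hn
  have h4 := sample_lt (show 0 < n by omega)
  rw [← hs] at h1 h2 h3 h4
  rcases lt_or_ge n 20 with h | h
  · exact weighted_bounds_small hn h h1 h2 hp₁ hp₂ hp₃
  · exact weighted_bounds_large h h1 h2 h3 h4.le hp₁ hp₂ hp₃

theorem first_le_half {n s : ℕ} (hn : 3 ≤ n) (hs : s = ⌊(n : ℝ) / Real.exp 1⌋₊) :
    s / n * recipSum s n ≤ 1 / 2 := by
  have h1 := sample_le n
  have h2 := lt_sample_add_one n
  have h3 := sample_pos hn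
  have h4 := sample_lt (show 0 < n by omega)
  rw [← hs] at h1 h2 h3 h4
  have hegt := Real.exp_one_gt_d9
  have helt := Real.exp_one_lt_d9
  have hs' : (0 : ℝ) < s := by exact_mod_cast h3
  have hn0 : (0 : ℝ) < n := by
    have : 0 < n := by omega
    exact_mod_cast this
  -- For `n ≥ 8` the bound `1 / n + 1 / e` is below 1/2. Smaller sizes are computed; equality occurs
  -- at `n = 3`, `s = 1`.
  rcases lt_or_ge n 8 with h | h
  · have h1' : (s : ℝ) * 2.718 ≤ n := by nlinarith
    have h2' : (n : ℝ) < (s + 1) * 2.719 := by nlinarith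
    have h5 : s * 2718 ≤ n * 1000 := by
      have : (s : ℝ) * 2718 ≤ n * 1000 := by linarith
      exact_mod_cast this
    have h6 : n * 1000 < (s + 1) * 2719 := by
      have : (n : ℝ) * 1000 < (s + 1) * 2719 := by linarith
      exact_mod_cast this
    clear hs h1 h2 h3 h4 h1' h2' hs' hn0
    unfold recipSum
    have hs1 : 0 < s := by omega
    have hs7 : s < 3 := by omega
    interval_cases s <;> interval_cases n <;> first
      | omega
      | norm_num [Finset.sum_Ico_eq_sum_range, Finset.sum_range_succ]
  · obtain ⟨m, rfl⟩ : ∃ m, n = m + 1 := ⟨n - 1, by omega⟩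
    have hsum := sum_le_log_ratio (n := m) h3 (by omega)
    rw [← recipSum] at hsum
    have hm0 : (0 : ℝ) < m := by
      have : 0 < m := by omega
      exact_mod_cast this
    have hlog : Real.log (m / s) ≤ ((m + 1 : ℕ) : ℝ) / (s * Real.exp 1) := by
      have h5 := Real.log_le_sub_one_of_pos (show (0 : ℝ) < m / (s * Real.exp 1) by positivity)
      rw [← div_div, Real.log_div (by positivity) (by positivity), Real.log_exp, div_div] at h5
      have h6 : (m : ℝ) / (s * Real.exp 1) ≤ ((m + 1 : ℕ) : ℝ) / (s * Real.exp 1) := by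
        apply div_le_div_of_nonneg_right _ (by positivity)
        push_cast
        linarith
      linarith
    have h8 : (8 : ℝ) ≤ ((m + 1 : ℕ) : ℝ) := by exact_mod_cast h
    calc (s : ℝ) / ((m + 1 : ℕ) : ℝ) * recipSum s (m + 1)
        ≤ (s : ℝ) / ((m + 1 : ℕ) : ℝ) * (1 / s + ((m + 1 : ℕ) : ℝ) / (s * Real.exp 1)) :=
          mul_le_mul_of_nonneg_left (by linarith) (by positivity)
      _ = 1 / ((m + 1 : ℕ) : ℝ) + 1 / Real.exp 1 := by field_simp
      _ ≤ 1 / 8 + 1 / 2.7182818283 :=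
          add_le_add (one_div_le_one_div_of_le (by norm_num) h8)
            (one_div_le_one_div_of_le (by norm_num) hegt.le)
      _ ≤ 1 / 2 := by norm_num

/-! ### The two properties of Dynkin's algorithm used later. -/

section SelectProb

variable {n : ℕ} {G : Type*} [Fintype G] {L : Type*} [LinearOrder L] {key : G → L}

theorem selectProb_le_half (hn : Fintype.card G = n) (hn2 : 2 ≤ n)
    (hkey : Function.Injective key) (x : G) :
    selectProb n key ⌊(n : ℝ) / Real.exp 1⌋₊ x ≤ 1 / 2 := by
  -- As `2 < e`, a group of size two has an empty sample, and each element is selected with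
  -- probability exactly 1/2.
  rcases Nat.lt_or_ge n 3 with h | h
  · obtain rfl : n = 2 := by omega
    have h0 : ⌊((2 : ℕ) : ℝ) / Real.exp 1⌋₊ = 0 := by
      rw [Nat.floor_eq_zero, div_lt_one (Real.exp_pos 1)]
      have := Real.exp_one_gt_d9
      push_cast
      linarith
    rw [h0, selectProb_zero hn (by norm_num)]
    norm_num
  · refine (selectProb_le_sum hn hkey (sample_pos h) x).trans ?_
    rw [sum_first]
    exact first_le_half h rfl

/-- Lower bound for the probability of selecting `c` or something larger, with a premium on `c`
itself. -/
theorem weighted_selectProb_ge (hn : Fintype.card G = n) (hn2 : 2 ≤ n)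
    (hkey : Function.Injective key) (c : G) :
    4 ≤ 7.12 * ∑ x with key c < key x, selectProb n key ⌊(n : ℝ) / Real.exp 1⌋₊ x
      + 10.98 * selectProb n key ⌊(n : ℝ) / Real.exp 1⌋₊ c := by
  classical
  rcases Nat.lt_or_ge n 3 with h | h
  · obtain rfl : n = 2 := by omega
    have h0 : ⌊((2 : ℕ) : ℝ) / Real.exp 1⌋₊ = 0 := by
      rw [Nat.floor_eq_zero, div_lt_one (Real.exp_pos 1)]
      have := Real.exp_one_gt_d9
      push_cast
      linarith
    have h1 := Finset.sum_nonneg (s := Finset.univ.filter (fun x => key c < key x))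
      (fun x _ => selectProb_nonneg (n := 2) key ⌊((2 : ℕ) : ℝ) / Real.exp 1⌋₊ x)
    have h2 : selectProb 2 key ⌊((2 : ℕ) : ℝ) / Real.exp 1⌋₊ c = 1 / 2 := by
      rw [h0, selectProb_zero hn (by norm_num)]
      norm_num
    rw [h2]
    linarith
  · obtain ⟨s, hs⟩ : ∃ s, s = ⌊(n : ℝ) / Real.exp 1⌋₊ := ⟨_, rfl⟩
    have hs0 : 0 < s := hs ▸ sample_pos h
    have hsn : s ≤ n := hs ▸ (sample_lt (by omega)).le
    rw [← hs]
    obtain ⟨b1, b2, b3⟩ := weighted_bounds h hs rfl rfl rfl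
    have f1 := fun x hx => sum_first s n ▸ selectProb_first (s := s) hn hkey hs0 x hx
    have f2 := fun x y hxy hx => sum_second hs0 hsn ▸
      selectProb_second (s := s) (x := x) (y := y) hn hkey hs0 hxy hx
    have f3 := fun x y z hxy hxz hyz hx => sum_third hs0 hsn ▸
      selectProb_third (s := s) (x := x) (y := y) (z := z) hn hkey hs0 hxy hxz hyz hx
    have hq := fun x => selectProb_nonneg (n := n) key s x
    obtain ⟨T, hT⟩ : ∃ T : Finset G, T = Finset.univ.filter (fun x => key c < key x) := ⟨_, rfl⟩
    have hTmem : ∀ x, x ∈ T ↔ key c < key x := by simp [hT]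
    have hcT : c ∉ T := by simp [hTmem]
    rw [← hT]
    have hlow : ∀ x, x ∉ insert c T → ∀ y ∈ insert c T, key x ≤ key y := by
      intro x hx y hy
      rw [Finset.mem_insert, not_or, hTmem, not_lt] at hx
      rw [Finset.mem_insert, hTmem] at hy
      rcases hy with rfl | hy
      · exact hx.2
      · exact hx.2.trans hy.le
    have hcmin : ∀ y ∈ insert c T, key c ≤ key y := by
      intro y hy
      rw [Finset.mem_insert, hTmem] at hy
      rcases hy with rfl | hy
      · exact le_rfl
      · exact hy.le
    obtain ⟨x, hxT, hxmax⟩ := Finset.exists_max_image (insert c T) key ⟨c, by simp⟩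
    have hx : ∀ y, key y ≤ key x := by
      intro y
      by_cases hy : y ∈ insert c T
      · exact hxmax y hy
      · exact hlow y hy x hxT
    -- The three inequalities of `weighted_bounds` correspond to zero, one, or at least two elements
    -- above `c`.
    rcases T.eq_empty_or_nonempty with hT0 | hTne
    · have hxc : x = c := by simpa [hT0] using hxT
      rw [hT0, Finset.sum_empty]
      have := f1 c (hxc ▸ hx)
      linarith
    have hxT' : x ∈ T := by
      obtain ⟨y, hy⟩ := hTne
      rw [hTmem] at hy ⊢
      exact hy.trans_le (hx y)
    have hcx : c ≠ x := fun h => hcT (h ▸ hxT')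
    obtain ⟨y, hyT, hymax⟩ := Finset.exists_max_image ((insert c T).erase x) key
      ⟨c, by simp [hcx]⟩
    have hyx : y ≠ x := (Finset.mem_erase.mp hyT).1
    have hy : ∀ z, z ≠ x → key z ≤ key y := by
      intro z hz
      by_cases hzT : z ∈ insert c T
      · exact hymax z (Finset.mem_erase.mpr ⟨hz, hzT⟩)
      · exact hlow z hzT y (Finset.mem_erase.mp hyT).2
    by_cases hyc : y = c
    · have e1 := f1 x hx
      have e2 := f2 c x hcx (hyc ▸ hy)
      have e3 : selectProb n key s x ≤ ∑ x ∈ T, selectProb n key s x :=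
        Finset.single_le_sum (fun x _ => hq x) hxT'
      linarith
    · have hyT' : y ∈ T := by
        rcases Finset.mem_insert.mp (Finset.mem_erase.mp hyT).2 with h | h
        · exact absurd h hyc
        · exact h
      -- Here `z` has rank three and may be `c` or better. The smaller weight 7.12 already suffices
      -- for the top three ranks together.
      obtain ⟨z, hzT, hzmax⟩ := Finset.exists_max_image (((insert c T).erase x).erase y) key
        ⟨c, by simp [hcx, Ne.symm hyc]⟩
      obtain ⟨hzy, hzT⟩ := Finset.mem_erase.mp hzT
      obtain ⟨hzx, hzT⟩ := Finset.mem_erase.mp hzT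
      have hz : ∀ w, w ≠ x → w ≠ y → key w ≤ key z := by
        intro w hwx hwy
        by_cases hwT : w ∈ insert c T
        · exact hzmax w (Finset.mem_erase.mpr ⟨hwy, Finset.mem_erase.mpr ⟨hwx, hwT⟩⟩)
        · exact hlow w hwT z hzT
      have e1 := f1 x hx
      have e2 := f2 y x hyx hy
      have e3 := f3 z x y hzx hzy hyx.symm hz
      have e4 : selectProb n key s x + (selectProb n key s y + selectProb n key s z)
          ≤ ∑ u ∈ insert c T, selectProb n key s u := by
        have hsub : ({x, y, z} : Finset G) ⊆ insert c T := by
          intro u hu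
          simp only [Finset.mem_insert, Finset.mem_singleton] at hu
          rcases hu with rfl | rfl | rfl
          · exact hxT
          · exact (Finset.mem_erase.mp hyT).2
          · exact hzT
        have := Finset.sum_le_sum_of_subset_of_nonneg hsub
          (fun u _ _ => hq u)
        rwa [Finset.sum_insert (by simp [hyx.symm, hzx.symm]), Finset.sum_pair hzy.symm] at this
      rw [Finset.sum_insert hcT] at e4
      have := hq c
      linarith

end SelectProb

/-! ### Submodularity and the dominated-set argument. -/

section Submodular

variable {α : Type*} [DecidableEq α] {f : Finset α → ℝ}

theorem marginal_of_mem (f : Finset α → ℝ) {S : Finset α} {x : α} (hx : x ∈ S) :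
    marginal f S x = 0 := by
  have : S ∪ {x} = S := Finset.union_eq_left.mpr (Finset.singleton_subset_iff.mpr hx)
  rw [marginal, this, sub_self]

/-- Diminishing returns. -/
theorem IsSubmodular.marginal_le (hf : IsSubmodular f) {S T : Finset α} (hST : S ⊆ T) {x : α}
    (hx : x ∈ T → x ∈ S) : marginal f T x ≤ marginal f S x := by
  by_cases hxS : x ∈ S
  · rw [marginal_of_mem f hxS, marginal_of_mem f (hST hxS)]
  · have hxT : x ∉ T := fun h => hxS (hx h)
    have h := hf (S ∪ {x}) T
    have e1 : S ∪ {x} ∪ T = T ∪ {x} := by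
      rw [Finset.union_right_comm, Finset.union_eq_right.mpr hST]
    have e2 : (S ∪ {x}) ∩ T = S := by
      rw [Finset.union_inter_distrib_right, Finset.inter_eq_left.mpr hST,
        Finset.singleton_inter_of_notMem hxT, Finset.union_empty]
    rw [e1, e2] at h
    unfold marginal
    linarith

/-- Diminishing returns, one element at a time. The condition on `N` excludes elements of `B`
outside `X`: their marginal over `B` is zero, which can exceed a negative marginal over `X`. -/
theorem IsSubmodular.union_le (hf : IsSubmodular f) {X B : Finset α} (hXB : X ⊆ B)
    (N : Finset α) (hN : ∀ x ∈ N, x ∈ B → x ∈ X) :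
    f (B ∪ N) ≤ f B + ∑ x ∈ N, marginal f X x := by
  induction N using Finset.induction_on with
  | empty => simp
  | insert x N hx ih =>
    have h1 := ih (fun y hy => hN y (Finset.mem_insert_of_mem hy))
    have h2 : marginal f (B ∪ N) x ≤ marginal f X x := by
      refine hf.marginal_le (hXB.trans Finset.subset_union_left) fun h => ?_
      rcases Finset.mem_union.mp h with h | h
      · exact hN x (Finset.mem_insert_self x N) h
      · exact absurd h hx
    have h3 : B ∪ insert x N = B ∪ N ∪ {x} := by
      rw [Finset.insert_eq, Finset.union_assoc, Finset.union_comm {x} N]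
    have h4 : f (B ∪ N ∪ {x}) = f (B ∪ N) + marginal f (B ∪ N) x := by
      rw [marginal]
      ring
    rw [Finset.sum_insert hx, h3, h4]
    linarith

/-- The contribution of one round in `IsSubmodular.exists_dominated`: `A` is the set that is
added, `K` the set of candidates whose harmful members are put into the dominated set. -/
noncomputable def roundGain (f : Finset α → ℝ) (κ : ℝ) (X A K : Finset α) : ℝ :=
  ∑ x ∈ A, κ * marginal f X x + ∑ x ∈ K, (marginal f X x)⁻
    - ∑ x ∈ A, (if x ∈ K then (marginal f X x)⁺ else marginal f X x)

theorem union_eq_add_sum (f : Finset α → ℝ) (X : Finset α) {A : Finset α} (hA : A.card ≤ 1) :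
    f (X ∪ A) = f X + ∑ x ∈ A, marginal f X x := by
  rcases Nat.le_one_iff_eq_zero_or_eq_one.mp hA with h | h
  · rw [Finset.card_eq_zero.mp h]
    simp
  · obtain ⟨x, rfl⟩ := Finset.card_eq_one.mp h
    simp [marginal]

/-- If a set grows by at most one element of group `i` in round `i`, its value dominates the value
that remains after adding all candidates that were harmful when their group arrived. -/
theorem IsSubmodular.exists_dominated (hf : IsSubmodular f) (idx : α → ℕ) {κ : ℝ}
    (X A K : ℕ → Finset α) (hX : ∀ i, X (i + 1) = X i ∪ A i) (hA1 : ∀ i, (A i).card ≤ 1)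
    (hA : ∀ i, ∀ x ∈ A i, idx x = i) (hK : ∀ i, ∀ x ∈ K i, idx x = i) (n : ℕ) :
    ∃ Y : Finset α, (∀ x ∈ Y, idx x < n ∧ x ∈ K (idx x)) ∧
      f (X n ∪ Y) + (κ - 1) * f (X 0) + ∑ i ∈ Finset.range n, roundGain f κ (X i) (A i) (K i)
        ≤ κ * f (X n) := by
  induction n with
  | zero => exact ⟨∅, by simp, by simp; linarith⟩
  | succ n ih =>
    obtain ⟨Y, hY, h⟩ := ih
    -- All harmful candidates of the round join `Y`, whether accepted or not. An accepted harmful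
    -- candidate is thus already present and is not added again with `A n`; this is why only
    -- positive parts are subtracted in `roundGain` for elements of `K`.
    set N := (K n).filter (fun x => marginal f (X n) x < 0) with hN
    refine ⟨Y ∪ N, ?_, ?_⟩
    · intro x hx
      rcases Finset.mem_union.mp hx with hx | hx
      · exact ⟨(hY x hx).1.trans (Nat.lt_succ_self n), (hY x hx).2⟩
      · have hxK := (Finset.mem_filter.mp hx).1
        rw [hK n x hxK]
        exact ⟨Nat.lt_succ_self n, hxK⟩
    · have hBX : ∀ x, idx x = n → x ∈ X n ∪ Y → x ∈ X n := by
        intro x hxn hx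
        rcases Finset.mem_union.mp hx with hx | hx
        · exact hx
        · exact absurd hxn (hY x hx).1.ne
      have h1 := hf.union_le (X := X n) (B := X n ∪ Y) Finset.subset_union_left N
        (fun x hx => hBX x (hK n x (Finset.mem_filter.mp hx).1))
      have h2 := hf.union_le (X := X n) (B := X n ∪ Y ∪ N)
        (Finset.subset_union_left.trans Finset.subset_union_left) (A n \ N)
        (fun x hx hxB => by
          rw [Finset.mem_sdiff] at hx
          rcases Finset.mem_union.mp hxB with hxB | hxB
          · exact hBX x (hA n x hx.1) hxB
          · exact absurd hxB hx.2)
      have e1 : X n ∪ Y ∪ N ∪ A n \ N = X (n + 1) ∪ (Y ∪ N) := by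
        rw [hX]
        ext x
        simp only [Finset.mem_union, Finset.mem_sdiff]
        tauto
      have e2 : ∑ x ∈ N, marginal f (X n) x = - ∑ x ∈ K n, (marginal f (X n) x)⁻ := by
        rw [hN, Finset.sum_filter, ← Finset.sum_neg_distrib]
        refine Finset.sum_congr rfl fun x _ => ?_
        split_ifs with hx
        · rw [negPart_of_nonpos hx.le, neg_neg]
        · rw [negPart_of_nonneg (not_lt.mp hx), neg_zero]
      have e3 : ∑ x ∈ A n \ N, marginal f (X n) x
          = ∑ x ∈ A n, (if x ∈ K n then (marginal f (X n) x)⁺ else marginal f (X n) x) := by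
        rw [← Finset.sum_sdiff (Finset.inter_subset_left : A n ∩ N ⊆ A n)]
        have : ∑ x ∈ A n ∩ N, (if x ∈ K n then (marginal f (X n) x)⁺ else marginal f (X n) x)
            = 0 := by
          refine Finset.sum_eq_zero fun x hx => ?_
          have := Finset.mem_filter.mp (Finset.mem_inter.mp hx).2
          rw [if_pos this.1, posPart_of_nonpos this.2.le]
        rw [this, add_zero, Finset.sdiff_inter_self_left]
        refine Finset.sum_congr rfl fun x hx => ?_
        split_ifs with hxK
        · rw [posPart_of_nonneg]
          by_contra hneg
          exact (Finset.mem_sdiff.mp hx).2 (Finset.mem_filter.mpr ⟨hxK, not_le.mp hneg⟩)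
        · rfl
      have e4 := union_eq_add_sum f (X n) (hA1 n)
      rw [← hX] at e4
      rw [e1, e3] at h2
      rw [e2] at h1
      rw [Finset.sum_range_succ, roundGain, ← Finset.mul_sum]
      have e5 : κ * f (X (n + 1)) = κ * f (X n) + κ * ∑ x ∈ A n, marginal f (X n) x := by
        rw [e4]; ring
      linarith

/-- The value of a set that grows by at most one element per round, by its marginal values. -/
theorem sum_marginal_eq (X A : ℕ → Finset α) (hX : ∀ i, X (i + 1) = X i ∪ A i)
    (hA1 : ∀ i, (A i).card ≤ 1) (n : ℕ) :
    f (X n) = f (X 0) + ∑ i ∈ Finset.range n, ∑ x ∈ A i, marginal f (X i) x := by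
  induction n with
  | zero => simp
  | succ n ih => rw [Finset.sum_range_succ, hX, union_eq_add_sum f _ (hA1 n), ih]; ring

end Submodular

/-! ### Random discarding and submodularity. -/

section Sampling

variable {α : Type*} [Fintype α] [DecidableEq α] {f : Finset α → ℝ}

/-- The set of those elements of `S` that are kept by the discarding coins. -/
def keep (d : α → Bool) (S : Finset α) : Finset α := S.filter (fun x => d x = true)

/-- Sampling `Q` independently loses at most half compared with taking all or nothing of `Q`. -/
theorem IsSubmodular.sum_keep_ge (hf : IsSubmodular f) {X Q : Finset α} (hQ : Q ⊆ X)
    (Y : Finset α) (hY : Disjoint Y Q) :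
    ∑ d : α → Bool, f (Y ∪ Q ∪ keep d (X \ Q)) + ∑ d : α → Bool, f (Y ∪ keep d (X \ Q))
      ≤ 2 * ∑ d : α → Bool, f (Y ∪ keep d X) := by
  -- Reversing the coins on `Q` preserves the uniform distribution. For `d` and `T d` together, the
  -- union of the kept sets contains all of `Q` and the intersection none of it.
  let T : (α → Bool) → (α → Bool) := fun d x => if x ∈ Q then !(d x) else d x
  have hT : ∀ d, T (T d) = d := by
    intro d
    ext x
    by_cases hx : x ∈ Q <;> simp [T, hx]
  have hsum : ∑ d : α → Bool, f (Y ∪ keep (T d) X) = ∑ d : α → Bool, f (Y ∪ keep d X) :=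
    Fintype.sum_equiv ⟨T, T, hT, hT⟩ _ _ (fun _ => rfl)
  rw [two_mul]
  nth_rewrite 2 [← hsum]
  rw [← Finset.sum_add_distrib, ← Finset.sum_add_distrib]
  refine Finset.sum_le_sum fun d _ => ?_
  refine le_trans (le_of_eq ?_) (hf (Y ∪ keep d X) (Y ∪ keep (T d) X))
  congr 2
  · ext x
    have h1 := @hQ x
    by_cases hx : x ∈ Q <;> cases h : d x <;> simp [keep, T, hx, h] <;> tauto
  · ext x
    have h1 := @hQ x
    have h2 : x ∈ Y → x ∉ Q := fun h => Finset.disjoint_left.mp hY h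
    by_cases hx : x ∈ Q <;> cases h : d x <;> simp [keep, T, hx, h] <;> tauto

theorem sum_coin (x : α) :
    2 * ∑ d : α → Bool, (if d x = true then (1 : ℝ) else 0) = Fintype.card (α → Bool) := by
  let T : (α → Bool) → (α → Bool) := fun d => Function.update d x (!(d x))
  have hT : ∀ d, T (T d) = d := by
    intro d
    simp [T]
  have hsum : ∑ d : α → Bool, (if T d x = true then (1 : ℝ) else 0)
      = ∑ d : α → Bool, (if d x = true then (1 : ℝ) else 0) :=
    Fintype.sum_equiv ⟨T, T, hT, hT⟩ _ _ (fun _ => rfl)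
  rw [two_mul]
  nth_rewrite 2 [← hsum]
  rw [← Finset.sum_add_distrib, ← Finset.card_univ, Finset.card_eq_sum_ones, Nat.cast_sum]
  refine Finset.sum_congr rfl fun d _ => ?_
  cases h : d x <;> simp [T, h]

end Sampling

/-- The elements of group `j`. -/
def members {α : Type*} [Fintype α] {r : ℕ} (grp : α → Fin r) (j : Fin r) : Finset α :=
  Finset.univ.filter (fun x => grp x = j)

theorem mem_members {α : Type*} [Fintype α] {r : ℕ} {grp : α → Fin r} {j : Fin r} {x : α} :
    x ∈ members grp j ↔ grp x = j := by
  simp [members]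

theorem sum_members {α : Type*} [Fintype α] {r : ℕ} {grp : α → Fin r} (j : Fin r) (φ : α → ℝ) :
    ∑ x ∈ members grp j, φ x = ∑ x : {x : α // grp x = j}, φ x := by
  rw [Finset.sum_subtype (p := fun x => grp x = j) _ (fun x => mem_members)]

/-! ### Runs, resampling one group, and conditional acceptance probabilities. -/

section Acceptance

variable {α : Type*} [Fintype α] [LinearOrder α] {r : ℕ} {grp : α → Fin r}

/-- The arrival orders of the groups together with one coin per group. -/
abbrev Run (grp : α → Fin r) : Type _ :=
  (∀ j : Fin r, Fin (Fintype.card {x : α // grp x = j}) ≃ {x : α // grp x = j}) × (Fin r → Bool)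

/-- The element that Dynkin's algorithm selects from group `j`. -/
noncomputable def pick (f : Finset α → ℝ) (ω : Run grp) (S : Finset α) (j : Fin r) : Option α :=
  dynkin (marginal f S) (List.ofFn (fun i => ((ω.1 j i : {x : α // grp x = j}) : α)))

/-- What is added to the current set `S` when group `i` arrives. -/
noncomputable def added (f : Finset α → ℝ) (ω : Run grp) (S : Finset α) (i : ℕ) : Finset α :=
  if h : i < r then (if ω.2 ⟨i, h⟩ = true then (pick f ω S ⟨i, h⟩).toFinset else ∅) else ∅

/-- The set selected from the first `i` groups. -/
noncomputable def state (f : Finset α → ℝ) (ω : Run grp) : ℕ → Finset α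
  | 0 => ∅
  | i + 1 => state f ω i ∪ added f ω (state f ω i) i

/-- The element accepted from group `i`, as a set. -/
noncomputable def accepted (f : Finset α → ℝ) (ω : Run grp) (i : ℕ) : Finset α :=
  added f ω (state f ω i) i

theorem state_succ (f : Finset α → ℝ) (ω : Run grp) (i : ℕ) :
    state f ω (i + 1) = state f ω i ∪ accepted f ω i := rfl

theorem pick_eq_some_grp {f : Finset α → ℝ} {ω : Run grp} {S : Finset α} {j : Fin r} {x : α}
    (h : pick f ω S j = some x) : grp x = j := by
  have h1 : x ∈ List.ofFn (fun i => ((ω.1 j i : {x : α // grp x = j}) : α)) :=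
    List.mem_of_mem_drop (List.mem_of_find?_eq_some h)
  obtain ⟨i, rfl⟩ := (List.mem_ofFn' _ _).mp h1
  exact (ω.1 j i).2

theorem accepted_card_le (f : Finset α → ℝ) (ω : Run grp) (i : ℕ) :
    (accepted f ω i).card ≤ 1 := by
  unfold accepted added
  split_ifs
  · cases pick f ω (state f ω i) ⟨i, _⟩ <;> simp
  · simp
  · simp

theorem accepted_grp (f : Finset α → ℝ) (ω : Run grp) (i : ℕ) :
    ∀ x ∈ accepted f ω i, (grp x : ℕ) = i := by
  intro x hx
  unfold accepted added at hx
  split_ifs at hx with h1 h2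
  · rw [Option.mem_toFinset, Option.mem_def] at hx
    rw [pick_eq_some_grp hx]
  · simp at hx
  · simp at hx

theorem mem_state_iff (f : Finset α → ℝ) (ω : Run grp) (n : ℕ) (x : α) :
    x ∈ state f ω n ↔ (grp x : ℕ) < n ∧ x ∈ accepted f ω (grp x) := by
  induction n with
  | zero => simp [state]
  | succ n ih =>
    rw [state_succ, Finset.mem_union, ih]
    constructor
    · rintro (h | h)
      · exact ⟨h.1.trans (Nat.lt_succ_self n), h.2⟩
      · have := accepted_grp f ω n x h
        exact ⟨by omega, by rwa [this]⟩
    · rintro ⟨h1, h2⟩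
      rcases Nat.lt_succ_iff_lt_or_eq.mp h1 with h | h
      · exact Or.inl ⟨h, h2⟩
      · exact Or.inr (by rwa [h] at h2)

theorem state_mono (f : Finset α → ℝ) (ω : Run grp) {m n : ℕ} (h : m ≤ n) :
    state f ω m ⊆ state f ω n := by
  intro x hx
  rw [mem_state_iff] at hx ⊢
  exact ⟨hx.1.trans_le h, hx.2⟩

/-- Replacing the arrival order and the coin of group `j`. -/
def resample (ω : Run grp) (j : Fin r)
    (y : (Fin (Fintype.card {x : α // grp x = j}) ≃ {x : α // grp x = j}) × Bool) : Run grp :=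
  (Function.update ω.1 j y.1, Function.update ω.2 j y.2)

/-- Exchanging the data of group `j` with fresh data is an involution on pairs of a run and fresh
data. This serves as conditioning on everything outside group `j`. -/
theorem sum_resample (j : Fin r) (g : Run grp → ℝ) :
    ∑ ω : Run grp, ∑ y, g (resample ω j y)
      = (Nat.factorial (Fintype.card {x : α // grp x = j}) * 2 : ℝ) * ∑ ω : Run grp, g ω := by
  have hcard : (Fintype.card ((Fin (Fintype.card {x : α // grp x = j}) ≃ {x : α // grp x = j})
      × Bool) : ℝ) = Nat.factorial (Fintype.card {x : α // grp x = j}) * 2 := by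
    rw [Fintype.card_prod, Fintype.card_equiv (Fintype.equivFin _).symm]
    simp
  rw [← Fintype.sum_prod_type']
  let T : Run grp × ((Fin (Fintype.card {x : α // grp x = j}) ≃ {x : α // grp x = j}) × Bool) →
    Run grp × ((Fin (Fintype.card {x : α // grp x = j}) ≃ {x : α // grp x = j}) × Bool) :=
    fun p => (resample p.1 j p.2, (p.1.1 j, p.1.2 j))
  have hT : ∀ p, T (T p) = p := by
    rintro ⟨⟨o, c⟩, ⟨τ, b⟩⟩
    simp [T, resample]
  have hsum : ∑ p : Run grp × ((Fin (Fintype.card {x : α // grp x = j}) ≃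
      {x : α // grp x = j}) × Bool), g (resample p.1 j p.2) = ∑ p : Run grp × ((Fin (Fintype.card
        {x : α // grp x = j}) ≃ {x : α // grp x = j}) × Bool), g p.1 :=
    Fintype.sum_equiv ⟨T, T, hT, hT⟩ _ _ (fun _ => rfl)
  rw [hsum, Fintype.sum_prod_type, ← hcard, Finset.mul_sum]
  refine Finset.sum_congr rfl fun ω _ => ?_
  simp

theorem added_resample_of_ne (f : Finset α → ℝ) (ω : Run grp) (j : Fin r) (y) (S : Finset α)
    {i : ℕ} (h : i ≠ j) : added f (resample ω j y) S i = added f ω S i := by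
  unfold added pick resample
  by_cases hi : i < r
  · have hne : (⟨i, hi⟩ : Fin r) ≠ j := fun e => h (congrArg Fin.val e)
    simp only [hi, dif_pos, Function.update_of_ne hne]
  · simp only [hi, dif_neg, not_false_eq_true]

theorem state_resample (f : Finset α → ℝ) (ω : Run grp) (j : Fin r) (y) {i : ℕ}
    (h : i ≤ (j : ℕ)) : state f (resample ω j y) i = state f ω i := by
  induction i with
  | zero => rfl
  | succ i ih =>
    rw [state, state, ih (by omega), added_resample_of_ne f ω j y _ (by omega)]

/-- The size of group `j`. -/
def groupSize (grp : α → Fin r) (j : Fin r) : ℕ := Fintype.card {y : α // grp y = j}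

/-- The probability that `x` is accepted from its group when the current set is `S`. -/
noncomputable def acceptProb (f : Finset α → ℝ) (grp : α → Fin r) (S : Finset α) (x : α) : ℝ :=
  selectProb (groupSize grp (grp x))
    (fun y : {y : α // grp y = grp x} => rankKey (marginal f S) (y : α))
    ⌊((groupSize grp (grp x) : ℕ) : ℝ) / Real.exp 1⌋₊ ⟨x, rfl⟩ / 2

theorem acceptProb_eq (f : Finset α → ℝ) (S : Finset α) (j : Fin r) (x : {x : α // grp x = j}) :
    acceptProb f grp S x = selectProb (groupSize grp j)
      (fun y : {y : α // grp y = j} => rankKey (marginal f S) (y : α))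
      ⌊((groupSize grp j : ℕ) : ℝ) / Real.exp 1⌋₊ x / 2 := by
  obtain ⟨x, rfl⟩ := x
  rfl

/-- Averaging over the order and the coin of one group. -/
theorem sum_accepted (f : Finset α → ℝ) (j : Fin r) (φ : Run grp → α → ℝ)
    (hφ : ∀ ω y, φ (resample ω j y) = φ ω) :
    ∑ ω : Run grp, ∑ x ∈ accepted f ω j, φ ω x
      = ∑ ω : Run grp, ∑ x ∈ members grp j, acceptProb f grp (state f ω j) x * φ ω x := by
  classical
  have hf : (0 : ℝ) < Nat.factorial (Fintype.card {x : α // grp x = j}) := by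
    exact_mod_cast Nat.factorial_pos _
  have h2 : (0 : ℝ) < Nat.factorial (Fintype.card {x : α // grp x = j}) * 2 := by positivity
  rw [← mul_left_cancel_iff_of_pos h2, ← sum_resample, Finset.mul_sum]
  refine Finset.sum_congr rfl fun ω _ => ?_
  have hacc : ∀ y, ∑ x ∈ accepted f (resample ω j y) j, φ (resample ω j y) x
      = if y.2 = true then ∑ x : {x : α // grp x = j},
        (if Selects (fun z : {z : α // grp z = j} => rankKey (marginal f (state f ω j)) (z : α))
          ⌊((groupSize grp j : ℕ) : ℝ) / Real.exp 1⌋₊ y.1 x then φ ω x else 0) else 0 := by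
    rintro ⟨τ, b⟩
    rw [hφ, accepted, state_resample f ω j _ le_rfl, added, dif_pos j.2]
    have e1 : (resample ω j (τ, b)).2 ⟨(j : ℕ), j.2⟩ = b := by simp [resample]
    have e2 : pick f (resample ω j (τ, b)) (state f ω j) ⟨(j : ℕ), j.2⟩
        = dynkin (marginal f (state f ω j)) (List.ofFn (fun i => ((τ i : {x : α // grp x = j}) : α))) := by
      simp [pick, resample]
    rw [e1, e2]
    by_cases hb : b = true
    · rw [if_pos hb, if_pos hb, ← Finset.sum_filter]
      symm
      refine Finset.sum_bij (fun x _ => (x : α)) ?_ ?_ ?_ ?_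
      · intro x hx
        rw [Finset.mem_filter] at hx
        rw [Option.mem_toFinset, Option.mem_def]
        exact (dynkin_ofFn_eq_some_iff _ (fun x : {x : α // grp x = j} => (x : α))
          Subtype.val_injective τ x).mpr hx.2
      · intro x _ y _ h
        exact Subtype.ext h
      · intro x hx
        rw [Option.mem_toFinset, Option.mem_def] at hx
        have hg : grp x = j := by
          rw [← e2] at hx
          exact pick_eq_some_grp hx
        refine ⟨⟨x, hg⟩, ?_, rfl⟩
        rw [Finset.mem_filter]
        exact ⟨Finset.mem_univ _, (dynkin_ofFn_eq_some_iff _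
          (fun x : {x : α // grp x = j} => (x : α)) Subtype.val_injective τ ⟨x, hg⟩).mp hx⟩
      · intro _ _
        rfl
    · rw [if_neg hb, if_neg hb, Finset.sum_empty]
  rw [Finset.sum_congr rfl (fun y _ => hacc y), Fintype.sum_prod_type]
  simp only [Fintype.sum_bool, if_true, Bool.false_eq_true, if_false, add_zero]
  rw [Finset.sum_comm, sum_members, Finset.mul_sum]
  refine Finset.sum_congr rfl fun x _ => ?_
  rw [acceptProb_eq, selectProb, countOrders, ← Finset.sum_filter, Finset.sum_const, nsmul_eq_mul]
  unfold groupSize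
  have hne := hf.ne'
  field_simp
  rw [mul_comm]
  congr
  exact Subsingleton.elim _ _

end Acceptance

/-- `IsSubmodular.exists_dominated` for a process described by its final set: `S` has at most one
element of every index, and the elements are added to `X` in the order of their indices. -/
theorem IsSubmodular.exists_dominated_set {α : Type*} [DecidableEq α]
    {f : Finset α → ℝ} (hf : IsSubmodular f) {r : ℕ} (idx : α → ℕ) (hidx : ∀ x, idx x < r)
    (κ : ℝ) (X S K : Finset α) (hS : ∀ i, (S.filter (fun x => idx x = i)).card ≤ 1) :
    ∃ Y ⊆ K, f (X ∪ S ∪ Y) + (κ - 1) * f X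
      + (∑ x ∈ S, κ * marginal f (X ∪ S.filter (fun y => idx y < idx x)) x
        + ∑ x ∈ K, (marginal f (X ∪ S.filter (fun y => idx y < idx x)) x)⁻
        - ∑ x ∈ S, (if x ∈ K then (marginal f (X ∪ S.filter (fun y => idx y < idx x)) x)⁺
            else marginal f (X ∪ S.filter (fun y => idx y < idx x)) x)) ≤ κ * f (X ∪ S) := by
  obtain ⟨Y, hY, h⟩ := hf.exists_dominated idx (κ := κ)
    (fun i => X ∪ S.filter (fun x => idx x < i)) (fun i => S.filter (fun x => idx x = i))
    (fun i => K.filter (fun x => idx x = i))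
    (by
      intro i
      ext x
      simp only [Finset.mem_union, Finset.mem_filter, Nat.lt_succ_iff_lt_or_eq]
      tauto)
    hS (fun i x hx => (Finset.mem_filter.mp hx).2) (fun i x hx => (Finset.mem_filter.mp hx).2) r
  refine ⟨Y, fun x hx => (Finset.mem_filter.mp (hY x hx).2).1, ?_⟩
  have hfib : ∀ (T : Finset α) (g : ℕ → α → ℝ),
      ∑ i ∈ Finset.range r, ∑ x ∈ T.filter (fun x => idx x = i), g i x
        = ∑ x ∈ T, g (idx x) x := by
    intro T g
    rw [← Finset.sum_fiberwise_of_maps_to (s := T) (t := Finset.range r) (g := idx)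
      (fun x _ => Finset.mem_range.mpr (hidx x))]
    refine Finset.sum_congr rfl fun i _ => Finset.sum_congr rfl fun x hx => ?_
    rw [(Finset.mem_filter.mp hx).2]
  have hall : S.filter (fun x => idx x < r) = S := Finset.filter_true_of_mem fun x _ => hidx x
  have hnone : S.filter (fun x => idx x < 0) = ∅ := by simp
  simp only [hall, hnone, Finset.union_empty, roundGain, Finset.sum_sub_distrib,
    Finset.sum_add_distrib] at h
  rw [hfib S (fun i x => κ * marginal f (X ∪ S.filter (fun y => idx y < i)) x),
    hfib K (fun i x => (marginal f (X ∪ S.filter (fun y => idx y < i)) x)⁻),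
    hfib S (fun i x => if x ∈ K.filter (fun x => idx x = i) then
      (marginal f (X ∪ S.filter (fun y => idx y < i)) x)⁺ else
        marginal f (X ∪ S.filter (fun y => idx y < i)) x)] at h
  simpa only [Finset.mem_filter, and_true] using h

theorem sum_marginal_eq_set {α : Type*} [DecidableEq α]
    (f : Finset α → ℝ) {r : ℕ} (idx : α → ℕ) (hidx : ∀ x, idx x < r)
    (X S : Finset α) (hS : ∀ i, (S.filter (fun x => idx x = i)).card ≤ 1) :
    f (X ∪ S) = f X + ∑ x ∈ S, marginal f (X ∪ S.filter (fun y => idx y < idx x)) x := by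
  have h := sum_marginal_eq (f := f) (fun i => X ∪ S.filter (fun x => idx x < i))
    (fun i => S.filter (fun x => idx x = i))
    (by
      intro i
      ext x
      simp only [Finset.mem_union, Finset.mem_filter, Nat.lt_succ_iff_lt_or_eq]
      tauto) hS r
  have hall : S.filter (fun x => idx x < r) = S := Finset.filter_true_of_mem fun x _ => hidx x
  have hnone : S.filter (fun x => idx x < 0) = ∅ := by simp
  simp only [hall, hnone, Finset.union_empty] at h
  rw [h, ← Finset.sum_fiberwise_of_maps_to (s := S) (t := Finset.range r) (g := idx)
    (fun x _ => Finset.mem_range.mpr (hidx x))]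
  congr 1
  refine Finset.sum_congr rfl fun i _ => Finset.sum_congr rfl fun x hx => ?_
  rw [(Finset.mem_filter.mp hx).2]

/-! ### Groups of size one, late values, and the tradeoff within a group. -/

section Singles

/-- The elements that are alone in their group. -/
def singles {α : Type*} [Fintype α] {r : ℕ} (grp : α → Fin r) : Finset α :=
  Finset.univ.filter (fun x => groupSize grp (grp x) = 1)

theorem mem_singles {α : Type*} [Fintype α] {r : ℕ} {grp : α → Fin r} {x : α} :
    x ∈ singles grp ↔ groupSize grp (grp x) = 1 := by simp [singles]

theorem groupSize_pos {α : Type*} [Fintype α] {r : ℕ} {grp : α → Fin r} (x : α) :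
    0 < groupSize grp (grp x) :=
  Fintype.card_pos_iff.mpr ⟨⟨x, rfl⟩⟩

theorem two_le_groupSize {α : Type*} [Fintype α] {r : ℕ} {grp : α → Fin r} {x : α}
    (h : x ∉ singles grp) : 2 ≤ groupSize grp (grp x) := by
  rw [mem_singles] at h
  have := groupSize_pos (grp := grp) x
  omega

theorem rankKey_subtype_injective {α : Type*} [LinearOrder α] {r : ℕ} {grp : α → Fin r}
    (v : α → ℝ) (j : Fin r) :
    Function.Injective (fun y : {y : α // grp y = j} => rankKey v (y : α)) :=
  (rankKey_injective v).comp Subtype.val_injective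

variable {α : Type*} [Fintype α] [LinearOrder α] {r : ℕ} {grp : α → Fin r}
  {f : Finset α → ℝ}

theorem acceptProb_nonneg (S : Finset α) (x : α) : 0 ≤ acceptProb f grp S x :=
  div_nonneg (selectProb_nonneg _ _ _) zero_le_two

theorem acceptProb_le_quarter (S : Finset α) {x : α} (hx : x ∉ singles grp) :
    acceptProb f grp S x ≤ 1 / 4 := by
  have h := selectProb_le_half (G := {y : α // grp y = grp x}) rfl (two_le_groupSize hx)
    (rankKey_subtype_injective (marginal f S) (grp x)) ⟨x, rfl⟩
  rw [acceptProb]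
  unfold groupSize
  linarith

theorem acceptProb_single (S : Finset α) {x : α} (hx : x ∈ singles grp) :
    acceptProb f grp S x = 1 / 2 := by
  have h1 : groupSize grp (grp x) = 1 := mem_singles.mp hx
  have h0 : ⌊((1 : ℕ) : ℝ) / Real.exp 1⌋₊ = 0 := by
    rw [Nat.floor_eq_zero, div_lt_one (Real.exp_pos 1)]
    have := Real.exp_one_gt_d9
    push_cast
    linarith
  rw [acceptProb, h1, h0, selectProb_zero (by exact h1) Nat.one_pos]
  norm_num

theorem acceptProb_le_half (S : Finset α) (x : α) : acceptProb f grp S x ≤ 1 / 2 := by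
  by_cases hx : x ∈ singles grp
  · exact (acceptProb_single S hx).le
  · exact (acceptProb_le_quarter S hx).trans (by norm_num)

/-- The only element of a group of size one is always selected by Dynkin's algorithm. -/
theorem mem_state_single (ω : Run grp) {x : α} (hx : x ∈ singles grp) :
    x ∈ state f ω r ↔ ω.2 (grp x) = true := by
  rw [mem_state_iff, accepted, added, dif_pos (grp x).2]
  have h1 : Fintype.card {y : α // grp y = grp x} = 1 := mem_singles.mp hx
  have hp : pick f ω (state f ω (grp x)) (grp x) = some x := by
    have hsub : ∀ y z : {y : α // grp y = grp x}, y = z := fun y z =>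
      (Fintype.card_le_one_iff_subsingleton.mp h1.le).elim y z
    have h0 : ⌊((Fintype.card {y : α // grp y = grp x} : ℕ) : ℝ) / Real.exp 1⌋₊ = 0 := by
      rw [h1, Nat.floor_eq_zero, div_lt_one (Real.exp_pos 1)]
      have := Real.exp_one_gt_d9
      push_cast
      linarith
    refine (dynkin_ofFn_eq_some_iff _ (fun y : {y : α // grp y = grp x} => (y : α))
      Subtype.val_injective (ω.1 (grp x)) ⟨x, rfl⟩).mpr ?_
    rw [h0]
    refine ⟨⟨0, by omega⟩, Nat.zero_le _, hsub _ _, by simp, ?_⟩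
    intro u _ hu
    exact absurd hu (by simp [Fin.lt_def])
  simp only [Fin.eta, hp]
  by_cases hc : ω.2 (grp x) = true <;> simp [hc]

/-- The accepted elements of the groups of size one. -/
noncomputable def acceptedSingles (f : Finset α → ℝ) (ω : Run grp) : Finset α :=
  (state f ω r).filter (fun x => x ∈ singles grp)

/-- By `mem_state_single`, membership of a single depends only on the coin of its group, even for
groups arriving later. So the accepted singles may be treated as known in advance when a larger
group is averaged out. -/
theorem acceptedSingles_resample (ω : Run grp) (j : Fin r) (y) (hj : groupSize grp j ≠ 1) :
    acceptedSingles f (resample ω j y) = acceptedSingles f ω := by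
  ext x
  simp only [acceptedSingles, Finset.mem_filter]
  refine and_congr_left fun hx => ?_
  rw [mem_state_single _ hx, mem_state_single _ hx]
  have hne : grp x ≠ j := by
    rintro rfl
    exact hj (mem_singles.mp hx)
  simp [resample, Function.update_of_ne hne]

/-- The marginal value of `x` when its group arrives. -/
noncomputable def arrivalValue (f : Finset α → ℝ) (ω : Run grp) (x : α) : ℝ :=
  marginal f (state f ω (grp x)) x

/-- The marginal value of `x` with respect to the elements accepted from earlier groups and from
all groups of size one. -/
noncomputable def lateValue (f : Finset α → ℝ) (ω : Run grp) (x : α) : ℝ :=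
  marginal f (acceptedSingles f ω ∪ state f ω (grp x)) x

/-- The conditional probability that `x` is accepted, given the earlier groups. -/
noncomputable def prob (f : Finset α → ℝ) (ω : Run grp) (x : α) : ℝ :=
  acceptProb f grp (state f ω (grp x)) x

theorem arrivalValue_resample (ω : Run grp) (x : α) (y) :
    arrivalValue f (resample ω (grp x) y) x = arrivalValue f ω x := by
  rw [arrivalValue, arrivalValue, state_resample f ω _ _ le_rfl]

theorem lateValue_resample (ω : Run grp) {x : α} (hx : x ∉ singles grp) (y) :
    lateValue f (resample ω (grp x) y) x = lateValue f ω x := by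
  rw [lateValue, lateValue, state_resample f ω _ _ le_rfl,
    acceptedSingles_resample ω _ _ (fun h => hx (mem_singles.mpr h))]

/-- The averaging identity. -/
theorem sum_mem_state (P : Finset α) (φ : Run grp → α → ℝ)
    (hφ : ∀ x ∈ P, ∀ ω y, φ (resample ω (grp x) y) x = φ ω x) :
    ∑ ω : Run grp, ∑ x ∈ P, (if x ∈ state f ω r then φ ω x else 0)
      = ∑ ω : Run grp, ∑ x ∈ P, prob f ω x * φ ω x := by
  rw [Finset.sum_comm, Finset.sum_comm (f := fun ω x => prob f ω x * φ ω x)]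
  refine Finset.sum_congr rfl fun x hx => ?_
  have h := sum_accepted f (grp x) (fun ω z => if z = x then φ ω x else 0)
    (by
      intro ω y
      ext z
      split_ifs
      · exact hφ x hx ω y
      · rfl)
  have e1 : ∀ ω : Run grp, ∑ z ∈ accepted f ω (grp x), (if z = x then φ ω x else 0)
      = if x ∈ state f ω r then φ ω x else 0 := by
    intro ω
    rw [Finset.sum_ite_eq']
    simp only [mem_state_iff, (grp x).2, true_and]
  have e2 : ∀ ω : Run grp, ∑ z ∈ members grp (grp x), acceptProb f grp (state f ω (grp x)) z *
      (if z = x then φ ω x else 0) = prob f ω x * φ ω x := by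
    intro ω
    rw [Finset.sum_eq_single x]
    · simp [prob]
    · intro z _ hz
      simp [hz]
    · intro hx
      exact absurd (mem_members.mpr rfl) hx
  rw [Finset.sum_congr rfl (fun ω _ => (e1 ω).symm), h, Finset.sum_congr rfl (fun ω _ => e2 ω)]

/-- The tradeoff inside one group with at least two elements. -/
theorem group_tradeoff {C : Finset α} (hC : IsIndep grp C) (S : Finset α) (j : Fin r)
    (hj : groupSize grp j ≠ 1) (t : α → ℝ) (ht : ∀ x, grp x = j → t x ≤ marginal f S x)
    {κ₁ κ₂ κ₃ : ℝ} (h1 : 0 ≤ κ₁) (h2 : 0 ≤ κ₂) (h3 : 0 ≤ κ₃) (h3' : κ₃ ≤ 8)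
    (h12 : 7.12 ≤ κ₁ + κ₂) (h13 : 10.98 ≤ κ₁ + κ₃) :
    2 * ∑ x ∈ (members grp j).filter (fun x => x ∈ C), t x
      ≤ κ₁ * ∑ x ∈ members grp j, acceptProb f grp S x * (marginal f S x)⁺
        + κ₂ * ∑ x ∈ (members grp j).filter (fun x => x ∉ C),
          acceptProb f grp S x * (marginal f S x)⁺
        + κ₃ * ∑ x ∈ (members grp j).filter (fun x => x ∈ C), acceptProb f grp S x * t x := by
  have hnn : ∀ x, 0 ≤ acceptProb f grp S x * (marginal f S x)⁺ := fun x =>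
    mul_nonneg (acceptProb_nonneg S x) (posPart_nonneg _)
  have hs1 := Finset.sum_nonneg (s := members grp j) (fun x _ => hnn x)
  have hs2 := Finset.sum_nonneg (s := (members grp j).filter (fun x => x ∉ C)) (fun x _ => hnn x)
  have hcard : ((members grp j).filter (fun x => x ∈ C)).card ≤ 1 := by
    refine le_trans (le_of_eq ?_) (hC j)
    congr 1
    ext x
    simp [mem_members, and_comm]
  rcases Nat.le_one_iff_eq_zero_or_eq_one.mp hcard with h | h
  · rw [Finset.card_eq_zero.mp h]
    simp only [Finset.sum_empty, mul_zero, add_zero]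
    positivity
  · obtain ⟨c, hc⟩ := Finset.card_eq_one.mp h
    have hcm : c ∈ (members grp j).filter (fun x => x ∈ C) := by rw [hc]; simp
    rw [Finset.mem_filter, mem_members] at hcm
    obtain ⟨rfl, hcC⟩ := hcm
    have hcs : c ∉ singles grp := fun h => hj (mem_singles.mp h)
    rw [hc, Finset.sum_singleton, Finset.sum_singleton]
    have hpc := acceptProb_nonneg (f := f) (grp := grp) S c
    have hpc' := acceptProb_le_quarter (f := f) S hcs
    -- For a negative value, `κ₃ ≤ 8` and acceptance probability at most 1/4 give `κ₃ p ≤ 2`, so the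
    -- last term alone is at least `2 * t c`.
    rcases lt_or_ge (t c) 0 with htc | htc
    · have : κ₃ * (acceptProb f grp S c * t c) ≥ 2 * t c := by
        have h5 : κ₃ * acceptProb f grp S c ≤ 2 := by nlinarith
        nlinarith
      have := mul_nonneg h1 hs1
      have := mul_nonneg h2 hs2
      linarith
    -- `B` consists of the elements that Dynkin's algorithm ranks above `c`. None lies in `C`, so
    -- their gains count with both `κ₁` and `κ₂`, while `c` itself is counted with `κ₁` and `κ₃`.
    · set B := (members grp (grp c)).filter
        (fun x => rankKey (marginal f S) c < rankKey (marginal f S) x) with hB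
      set Q := ∑ x ∈ B, acceptProb f grp S x with hQ
      have hw : 2 ≤ 7.12 * Q + 10.98 * acceptProb f grp S c := by
        have h := weighted_selectProb_ge (G := {y : α // grp y = grp c}) rfl (two_le_groupSize hcs)
          (rankKey_subtype_injective (marginal f S) (grp c)) ⟨c, rfl⟩
        have e : Q = (∑ x ∈ (Finset.univ : Finset {y : α // grp y = grp c}).filter
            (fun x : {y : α // grp y = grp c} => rankKey (marginal f S) c < rankKey (marginal f S) (x : α)),
            selectProb (groupSize grp (grp c))
              (fun y : {y : α // grp y = grp c} => rankKey (marginal f S) (y : α))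
              ⌊((groupSize grp (grp c) : ℕ) : ℝ) / Real.exp 1⌋₊ x) / 2 := by
          rw [hQ, hB, Finset.sum_filter, sum_members, Finset.sum_filter, Finset.sum_div]
          refine Finset.sum_congr rfl fun x _ => ?_
          rw [acceptProb_eq]
          split_ifs <;> simp
        rw [e, acceptProb]
        unfold groupSize
        linarith
      have hval : ∀ x ∈ B, t c ≤ (marginal f S x)⁺ := by
        intro x hx
        have hlt := (Finset.mem_filter.mp hx).2
        rw [← beats_iff] at hlt
        have hle : marginal f S c ≤ marginal f S x := by
          rcases hlt with h | h
          · exact h.le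
          · exact h.1.le
        exact ((ht c rfl).trans hle).trans (le_posPart _)
      have hcB : c ∉ B := fun h => lt_irrefl _ (Finset.mem_filter.mp h).2
      have hBQ : t c * Q ≤ ∑ x ∈ B, acceptProb f grp S x * (marginal f S x)⁺ := by
        rw [hQ, Finset.mul_sum]
        refine Finset.sum_le_sum fun x hx => ?_
        rw [mul_comm]
        exact mul_le_mul_of_nonneg_left (hval x hx) (acceptProb_nonneg S x)
      have hsum1 : t c * Q + acceptProb f grp S c * t c
          ≤ ∑ x ∈ members grp (grp c), acceptProb f grp S x * (marginal f S x)⁺ := by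
        have hsub : insert c B ⊆ members grp (grp c) := by
          intro x hx
          rcases Finset.mem_insert.mp hx with rfl | hx
          · exact mem_members.mpr rfl
          · exact (Finset.mem_filter.mp hx).1
        have := Finset.sum_le_sum_of_subset_of_nonneg hsub (fun x _ _ => hnn x)
        rw [Finset.sum_insert hcB] at this
        have h6 := mul_le_mul_of_nonneg_left ((ht c rfl).trans (le_posPart _)) hpc
        linarith
      have hsum2 : t c * Q ≤ ∑ x ∈ (members grp (grp c)).filter (fun x => x ∉ C),
          acceptProb f grp S x * (marginal f S x)⁺ := by
        refine hBQ.trans (Finset.sum_le_sum_of_subset_of_nonneg ?_ (fun x _ _ => hnn x))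
        intro x hx
        refine Finset.mem_filter.mpr ⟨(Finset.mem_filter.mp hx).1, fun hxC => hcB ?_⟩
        have : x ∈ (members grp (grp c)).filter (fun x => x ∈ C) :=
          Finset.mem_filter.mpr ⟨(Finset.mem_filter.mp hx).1, hxC⟩
        rw [hc, Finset.mem_singleton] at this
        exact this ▸ hx
      have hQ0 : 0 ≤ Q := Finset.sum_nonneg fun x _ => acceptProb_nonneg S x
      have k1 := mul_le_mul_of_nonneg_left hsum1 h1
      have k2 := mul_le_mul_of_nonneg_left hsum2 h2
      have k3 : 2 * t c ≤ t c * ((κ₁ + κ₂) * Q + (κ₁ + κ₃) * acceptProb f grp S c) := by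
        rw [mul_comm]
        refine mul_le_mul_of_nonneg_left (hw.trans ?_) htc
        exact add_le_add (mul_le_mul_of_nonneg_right h12 hQ0)
          (mul_le_mul_of_nonneg_right h13 hpc)
      linarith

end Singles

/-! ### Averaged gains, losses, and late values. -/

section Averages

variable {α : Type*} [Fintype α] [LinearOrder α] {r : ℕ} {grp : α → Fin r}
  {f : Finset α → ℝ}

theorem state_filter_lt (ω : Run grp) (x : α) :
    (state f ω r).filter (fun y => (grp y : ℕ) < grp x) = state f ω (grp x) := by
  ext y
  simp only [Finset.mem_filter, mem_state_iff, (grp y).2, true_and]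
  tauto

theorem state_filter_card_le (ω : Run grp) (i : ℕ) :
    ((state f ω r).filter (fun x => (grp x : ℕ) = i)).card ≤ 1 := by
  refine (Finset.card_le_card ?_).trans (accepted_card_le f ω i)
  intro x hx
  rw [Finset.mem_filter, mem_state_iff] at hx
  rw [← hx.2]
  exact hx.1.2

theorem self_notMem_state (ω : Run grp) (x : α) : x ∉ state f ω (grp x) := by
  simp [mem_state_iff]

theorem state_subset (ω : Run grp) (x : α) : state f ω (grp x) ⊆ state f ω r :=
  state_mono f ω (grp x).2.le

theorem prob_nonneg (ω : Run grp) (x : α) : 0 ≤ prob f ω x := acceptProb_nonneg _ _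

theorem prob_le_half (ω : Run grp) (x : α) : prob f ω x ≤ 1 / 2 := acceptProb_le_half _ _

theorem prob_le_quarter (ω : Run grp) {x : α} (hx : x ∉ singles grp) : prob f ω x ≤ 1 / 4 :=
  acceptProb_le_quarter _ hx

theorem prob_single (ω : Run grp) {x : α} (hx : x ∈ singles grp) : prob f ω x = 1 / 2 :=
  acceptProb_single _ hx

theorem sum_state (φ : Run grp → α → ℝ)
    (hφ : ∀ x, ∀ ω y, φ (resample ω (grp x) y) x = φ ω x) :
    ∑ ω : Run grp, ∑ x ∈ state f ω r, φ ω x = ∑ ω : Run grp, ∑ x, prob f ω x * φ ω x := by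
  rw [← sum_mem_state Finset.univ φ (fun x _ => hφ x)]
  simp only [Finset.sum_ite_mem, Finset.univ_inter]

/-- The sum of `φ ω x` over all runs and all elements of `P`. -/
noncomputable def total (grp : α → Fin r) (φ : Run grp → α → ℝ) (P : Finset α) : ℝ :=
  ∑ ω : Run grp, ∑ x ∈ P, φ ω x

/-- The expected nonnegative part of the value gained from `x`. -/
noncomputable def gain (f : Finset α → ℝ) (ω : Run grp) (x : α) : ℝ :=
  prob f ω x * (arrivalValue f ω x)⁺

/-- The expected negative part of the value gained from `x`. -/
noncomputable def loss (f : Finset α → ℝ) (ω : Run grp) (x : α) : ℝ :=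
  prob f ω x * (arrivalValue f ω x)⁻

/-- The expected late value gained from `x`. -/
noncomputable def lateGain (f : Finset α → ℝ) (ω : Run grp) (x : α) : ℝ :=
  prob f ω x * lateValue f ω x

theorem gain_nonneg (ω : Run grp) (x : α) : 0 ≤ gain f ω x :=
  mul_nonneg (prob_nonneg ω x) (posPart_nonneg _)

theorem loss_nonneg (ω : Run grp) (x : α) : 0 ≤ loss f ω x :=
  mul_nonneg (prob_nonneg ω x) (negPart_nonneg _)

theorem total_nonneg {φ : Run grp → α → ℝ} (h : ∀ ω x, 0 ≤ φ ω x) (P : Finset α) :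
    0 ≤ total grp φ P :=
  Finset.sum_nonneg fun ω _ => Finset.sum_nonneg fun x _ => h ω x

theorem total_mono {φ : Run grp → α → ℝ} (h : ∀ ω x, 0 ≤ φ ω x) {P Q : Finset α} (hPQ : P ⊆ Q) :
    total grp φ P ≤ total grp φ Q :=
  Finset.sum_le_sum fun ω _ => Finset.sum_le_sum_of_subset_of_nonneg hPQ fun x _ _ => h ω x

theorem total_univ (φ : Run grp → α → ℝ) :
    total grp φ Finset.univ = total grp φ (singles grp) + total grp φ (singles grp)ᶜ := by
  simp only [total, ← Finset.sum_add_distrib, Finset.sum_add_sum_compl]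

theorem total_eq_univ (φ : Run grp → α → ℝ) (P : Finset α) :
    total grp φ P = ∑ ω : Run grp, ∑ x, if x ∈ P then φ ω x else 0 := by
  simp only [total, Finset.sum_ite_mem, Finset.univ_inter]

theorem sum_ite_state (P : Finset α) (φ : Run grp → α → ℝ)
    (hφ : ∀ x ∈ P, ∀ ω y, φ (resample ω (grp x) y) x = φ ω x) :
    ∑ ω : Run grp, ∑ x ∈ state f ω r, (if x ∈ P then φ ω x else 0)
      = total grp (fun ω x => prob f ω x * φ ω x) P := by
  rw [sum_state (fun ω x => if x ∈ P then φ ω x else 0), total_eq_univ]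
  · simp only [mul_ite, mul_zero]
  · intro x ω y
    by_cases hx : x ∈ P
    · simp only [hx, if_true, hφ x hx]
    · simp only [hx, if_false]

theorem lateValue_le (hf : IsSubmodular f) (ω : Run grp) {x : α} (hx : x ∉ singles grp) :
    lateValue f ω x ≤ arrivalValue f ω x := by
  refine hf.marginal_le Finset.subset_union_right fun h => ?_
  rcases Finset.mem_union.mp h with h | h
  · exact absurd (Finset.mem_filter.mp h).2 hx
  · exact h

/-- Adding the selected set to a fixed set loses at most half of its value. -/
theorem sum_union_ge (hf : IsSubmodular f) (hnn : ∀ S, 0 ≤ f S) (C : Finset α) :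
    (Fintype.card (Run grp) : ℝ) * f C ≤ 2 * ∑ ω : Run grp, f (state f ω r ∪ C) := by
  let w : Run grp → α → ℝ := fun ω x => marginal f (C ∪ state f ω (grp x)) x
  have key : ∀ ω : Run grp, f C + (∑ x ∈ state f ω r, (2 * w ω x - (w ω x)⁺) + ∑ x, (w ω x)⁻)
      ≤ 2 * f (state f ω r ∪ C) := by
    intro ω
    -- The process starts from `C` with `κ = 2`. The averaged round contribution of `x` is `p w⁺ +
    -- (1 - 2p) w⁻`, which is nonnegative as `p ≤ 1/2`.
    obtain ⟨Y, _, h⟩ := hf.exists_dominated_set (fun x => (grp x : ℕ)) (fun x => (grp x).2) 2 C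
      (state f ω r) Finset.univ (state_filter_card_le ω)
    simp only [state_filter_lt, Finset.mem_univ, if_true] at h
    have := hnn (C ∪ state f ω r ∪ Y)
    rw [Finset.union_comm (state f ω r) C, Finset.sum_sub_distrib]
    linarith
  have hsum := Finset.sum_le_sum (s := Finset.univ) (fun ω _ => key ω)
  rw [Finset.sum_add_distrib, Finset.sum_add_distrib, sum_state (fun ω x => 2 * w ω x - (w ω x)⁺),
    Finset.sum_const, nsmul_eq_mul, Finset.card_univ, ← Finset.sum_add_distrib,
    ← Finset.mul_sum] at hsum
  · refine le_trans ?_ hsum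
    rw [le_add_iff_nonneg_right]
    refine Finset.sum_nonneg fun ω _ => ?_
    rw [← Finset.sum_add_distrib]
    refine Finset.sum_nonneg fun x _ => ?_
    have h1 := posPart_sub_negPart (w ω x)
    have h2 := mul_nonneg (prob_nonneg (f := f) ω x) (posPart_nonneg (w ω x))
    have h3 := mul_nonneg (sub_nonneg.mpr (prob_le_half (f := f) ω x)) (negPart_nonneg (w ω x))
    generalize (w ω x)⁺ = p at *
    generalize (w ω x)⁻ = m at *
    rw [← h1]
    linarith
  · intro x ω y
    simp only [w, state_resample f ω _ _ le_rfl]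

/-- The value of the selected set in terms of the gains and losses at the times of arrival. -/
theorem gain_add_loss_le (hf : IsSubmodular f) (hnn : ∀ S, 0 ≤ f S) (h0 : f ∅ = 0) :
    total grp (gain f) (Finset.univ : Finset α) + 2 * total grp (loss f) (singles grp)ᶜ
      ≤ 2 * ∑ ω : Run grp, f (state f ω r) := by
  have key : ∀ ω : Run grp, ∑ x ∈ state f ω r, (2 * arrivalValue f ω x - (arrivalValue f ω x)⁺)
      + ∑ x, (arrivalValue f ω x)⁻ ≤ 2 * f (state f ω r) := by
    intro ω
    obtain ⟨Y, _, h⟩ := hf.exists_dominated_set (fun x => (grp x : ℕ)) (fun x => (grp x).2) 2 ∅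
      (state f ω r) Finset.univ (state_filter_card_le ω)
    simp only [state_filter_lt, Finset.mem_univ, if_true, Finset.empty_union, h0] at h
    have := hnn (state f ω r ∪ Y)
    rw [Finset.sum_sub_distrib]
    unfold arrivalValue
    linarith
  have hsum := Finset.sum_le_sum (s := Finset.univ) (fun ω _ => key ω)
  rw [Finset.sum_add_distrib,
    sum_state (fun ω x => 2 * arrivalValue f ω x - (arrivalValue f ω x)⁺)
      (fun x ω y => by rw [arrivalValue_resample]),
    ← Finset.sum_add_distrib, ← Finset.mul_sum] at hsum
  refine le_trans ?_ hsum
  rw [total_eq_univ (loss f), total, Finset.mul_sum, ← Finset.sum_add_distrib]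
  refine Finset.sum_le_sum fun ω _ => ?_
  rw [Finset.mul_sum, ← Finset.sum_add_distrib, ← Finset.sum_add_distrib]
  refine Finset.sum_le_sum fun x _ => ?_
  have h1 := posPart_sub_negPart (arrivalValue f ω x)
  have hm := negPart_nonneg (arrivalValue f ω x)
  unfold gain loss
  -- The coefficient `1 - 2p` of the negative part vanishes for singles. For the others `p ≤ 1/4`
  -- makes it at least `2p`, which gives twice the loss.
  by_cases hx : x ∈ singles grp
  · have h3 := mul_nonneg (sub_nonneg.mpr (prob_le_half (f := f) ω x)) hm
    simp only [Finset.mem_compl, hx, not_true_eq_false, if_false]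
    generalize (arrivalValue f ω x)⁺ = p at *
    generalize (arrivalValue f ω x)⁻ = m at *
    rw [← h1]
    linarith
  · have h3 := mul_nonneg (sub_nonneg.mpr (prob_le_quarter (f := f) ω hx)) hm
    simp only [Finset.mem_compl, hx, not_false_eq_true, if_true]
    generalize (arrivalValue f ω x)⁺ = p at *
    generalize (arrivalValue f ω x)⁻ = m at *
    rw [← h1]
    linarith

/-- Only harmful singles are put into the dominated set. Non-singles then contribute their signed
value, whence their loss on the right; it cancels against `exists_dominated_nonsingles`. -/
theorem exists_dominated_singles (hf : IsSubmodular f) (h0 : f ∅ = 0) :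
    ∃ Z : Run grp → Finset α, (∀ ω, Z ω ⊆ singles grp) ∧
      ∑ ω : Run grp, f (state f ω r ∪ Z ω) + total grp (gain f) (Finset.univ : Finset α)
        ≤ 2 * ∑ ω : Run grp, f (state f ω r) + total grp (loss f) (singles grp)ᶜ := by
  let φ : Run grp → α → ℝ := fun ω x => 2 * arrivalValue f ω x -
    (if x ∈ singles grp then (arrivalValue f ω x)⁺ else arrivalValue f ω x)
  have key : ∀ ω : Run grp, ∃ Z ⊆ singles grp, f (state f ω r ∪ Z) + (∑ x ∈ state f ω r, φ ω x
      + ∑ x, if x ∈ singles grp then (arrivalValue f ω x)⁻ else 0) ≤ 2 * f (state f ω r) := by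
    intro ω
    obtain ⟨Z, hZ, h⟩ := hf.exists_dominated_set (fun x => (grp x : ℕ)) (fun x => (grp x).2) 2 ∅
      (state f ω r) (singles grp) (state_filter_card_le ω)
    refine ⟨Z, hZ, ?_⟩
    simp only [state_filter_lt, Finset.empty_union, h0] at h
    rw [Finset.sum_sub_distrib, Finset.sum_ite_mem, Finset.univ_inter]
    unfold arrivalValue
    linarith
  choose Z hZ h using key
  refine ⟨Z, hZ, ?_⟩
  have hsum := Finset.sum_le_sum (s := Finset.univ) (fun ω _ => h ω)
  rw [Finset.sum_add_distrib, Finset.sum_add_distrib,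
    sum_state φ (fun x ω y => by simp only [φ, arrivalValue_resample]),
    ← Finset.sum_add_distrib, ← Finset.mul_sum] at hsum
  have : total grp (gain f) (Finset.univ : Finset α) ≤ ∑ ω : Run grp,
      (∑ x, prob f ω x * φ ω x + ∑ x, if x ∈ singles grp then (arrivalValue f ω x)⁻ else 0)
      + total grp (loss f) (singles grp)ᶜ := by
    rw [total_eq_univ (loss f), total, ← Finset.sum_add_distrib]
    refine Finset.sum_le_sum fun ω _ => ?_
    rw [← Finset.sum_add_distrib, ← Finset.sum_add_distrib]
    refine Finset.sum_le_sum fun x _ => ?_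
    have h1 := posPart_sub_negPart (arrivalValue f ω x)
    have hm := negPart_nonneg (arrivalValue f ω x)
    unfold gain loss
    by_cases hx : x ∈ singles grp
    · have h3 := mul_nonneg (sub_nonneg.mpr (prob_le_half (f := f) ω x)) hm
      simp only [φ, Finset.mem_compl, hx, not_true_eq_false, if_false, if_true]
      generalize (arrivalValue f ω x)⁺ = p at *
      generalize (arrivalValue f ω x)⁻ = m at *
      rw [← h1]
      linarith
    · simp only [φ, Finset.mem_compl, hx, not_false_eq_true, if_true, if_false]
      generalize (arrivalValue f ω x)⁺ = p at *
      generalize (arrivalValue f ω x)⁻ = m at *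
      rw [← h1]
      linarith
  linarith

/-- The process starts from the accepted singles, so marginals are late values and singles
contribute nothing. With `κ = 3` the average for a non-single is `2 p t⁺ + (1 - 3p) t⁻`, and `p ≤
1/4` gives `1 - 3p ≥ p`. Late negative parts are at least the negative parts on arrival, so this
covers the loss and, on `C`, also twice the late gain. -/
theorem exists_dominated_nonsingles (hf : IsSubmodular f) (hnn : ∀ S, 0 ≤ f S) (C : Finset α) :
    ∃ Y : Run grp → Finset α, (∀ ω, Y ω ⊆ (singles grp)ᶜ) ∧
      ∑ ω : Run grp, f (state f ω r ∪ Y ω) + 2 * total grp (lateGain f) ((singles grp)ᶜ ∩ C)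
        + total grp (loss f) (singles grp)ᶜ ≤ 3 * ∑ ω : Run grp, f (state f ω r) := by
  let φ : Run grp → α → ℝ := fun ω x => 3 * lateValue f ω x - (lateValue f ω x)⁺
  have key : ∀ ω : Run grp, ∃ Y ⊆ (singles grp)ᶜ, f (state f ω r ∪ Y)
      + (∑ x ∈ state f ω r, (if x ∈ (singles grp)ᶜ then φ ω x else 0)
      + ∑ x ∈ (singles grp)ᶜ, (lateValue f ω x)⁻) ≤ 3 * f (state f ω r) := by
    intro ω
    obtain ⟨Y, hY, h⟩ := hf.exists_dominated_set (fun x => (grp x : ℕ)) (fun x => (grp x).2) 3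
      (acceptedSingles f ω) (state f ω r) (singles grp)ᶜ (state_filter_card_le ω)
    refine ⟨Y, hY, ?_⟩
    have hH : acceptedSingles f ω ∪ state f ω r = state f ω r :=
      Finset.union_eq_right.mpr (Finset.filter_subset _ _)
    simp only [state_filter_lt, hH] at h
    have e : ∑ x ∈ state f ω r, (if x ∈ (singles grp)ᶜ then φ ω x else 0)
        = ∑ x ∈ state f ω r, (3 * lateValue f ω x - (if x ∈ (singles grp)ᶜ then
          (lateValue f ω x)⁺ else lateValue f ω x)) := by
      refine Finset.sum_congr rfl fun x hx => ?_
      by_cases hs : x ∈ singles grp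
      · have : lateValue f ω x = 0 := marginal_of_mem f
          (Finset.mem_union_left _ (Finset.mem_filter.mpr ⟨hx, hs⟩))
        simp [hs, this]
      · simp [hs, φ]
    have := hnn (acceptedSingles f ω)
    rw [e, Finset.sum_sub_distrib]
    unfold lateValue
    linarith
  choose Y hY h using key
  refine ⟨Y, hY, ?_⟩
  have hsum := Finset.sum_le_sum (s := Finset.univ) (fun ω _ => h ω)
  rw [Finset.sum_add_distrib, Finset.sum_add_distrib, sum_ite_state (singles grp)ᶜ φ
    (fun x hx ω y => by simp only [φ, lateValue_resample ω (Finset.mem_compl.mp hx)]),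
    ← Finset.mul_sum, total, ← Finset.sum_add_distrib] at hsum
  have : 2 * total grp (lateGain f) ((singles grp)ᶜ ∩ C) + total grp (loss f) (singles grp)ᶜ
      ≤ ∑ ω : Run grp, (∑ x ∈ (singles grp)ᶜ, prob f ω x * φ ω x
        + ∑ x ∈ (singles grp)ᶜ, (lateValue f ω x)⁻) := by
    rw [total, total, Finset.mul_sum, ← Finset.sum_add_distrib]
    refine Finset.sum_le_sum fun ω _ => ?_
    rw [← Finset.sum_ite_mem, Finset.mul_sum, ← Finset.sum_add_distrib, ← Finset.sum_add_distrib]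
    refine Finset.sum_le_sum fun x hx => ?_
    have hx := Finset.mem_compl.mp hx
    have h1 := posPart_sub_negPart (lateValue f ω x)
    have hm := negPart_nonneg (lateValue f ω x)
    have hp := posPart_nonneg (lateValue f ω x)
    have h2 : (arrivalValue f ω x)⁻ ≤ (lateValue f ω x)⁻ := negPart_anti (lateValue_le hf ω hx)
    have h3 := mul_nonneg (prob_nonneg (f := f) ω x) (sub_nonneg.mpr h2)
    have h4 := mul_nonneg (sub_nonneg.mpr (prob_le_quarter (f := f) ω hx)) hm
    have h5 := mul_nonneg (prob_nonneg (f := f) ω x) hp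
    unfold lateGain loss
    simp only [φ]
    generalize (lateValue f ω x)⁺ = p at *
    generalize (lateValue f ω x)⁻ = m at *
    rw [← h1]
    split_ifs <;> linarith
  linarith

theorem gain_add_lateGain_le (hf : IsSubmodular f) (hnn : ∀ S, 0 ≤ f S) (h0 : f ∅ = 0)
    (C : Finset α) :
    total grp (gain f) (Finset.univ : Finset α) + 2 * total grp (lateGain f) ((singles grp)ᶜ ∩ C)
      ≤ 4 * ∑ ω : Run grp, f (state f ω r) := by
  obtain ⟨Z, hZ, h1⟩ := exists_dominated_singles (grp := grp) hf h0
  obtain ⟨Y, hY, h2⟩ := exists_dominated_nonsingles (grp := grp) hf hnn C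
  have h3 : ∑ ω : Run grp, f (state f ω r)
      ≤ ∑ ω : Run grp, f (state f ω r ∪ Y ω) + ∑ ω : Run grp, f (state f ω r ∪ Z ω) := by
    rw [← Finset.sum_add_distrib]
    refine Finset.sum_le_sum fun ω _ => ?_
    -- `Y` consists of non-singles and `Z` of singles, so the two unions intersect exactly in the
    -- selected set.
    have h4 := hf (state f ω r ∪ Y ω) (state f ω r ∪ Z ω)
    have h5 : Disjoint (Y ω) (Z ω) :=
      Finset.disjoint_left.mpr fun x hx hz => Finset.mem_compl.mp (hY ω hx) (hZ ω hz)
    rw [← Finset.union_inter_distrib_left, Finset.disjoint_iff_inter_eq_empty.mp h5,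
      Finset.union_empty] at h4
    have := hnn (state f ω r ∪ Y ω ∪ (state f ω r ∪ Z ω))
    linarith
  linarith

/-- Only the members of `C` that were not accepted add anything. Their marginals over the final set
are at most the late value (non-singles) or the positive part on arrival (singles). The share of
accepted members is then subtracted on average; for singles it is exactly one half. -/
theorem sum_union_le (hf : IsSubmodular f) (C : Finset α) :
    ∑ ω : Run grp, f (state f ω r ∪ C) + total grp (lateGain f) ((singles grp)ᶜ ∩ C)
      ≤ ∑ ω : Run grp, f (state f ω r) + total grp (lateValue f) ((singles grp)ᶜ ∩ C)
        + total grp (fun ω x => (arrivalValue f ω x)⁺) (singles grp ∩ C) / 2 := by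
  have key : ∀ ω : Run grp, f (state f ω r ∪ C)
      + ∑ x ∈ state f ω r, (if x ∈ (singles grp)ᶜ ∩ C then lateValue f ω x else 0)
      + ∑ x ∈ state f ω r, (if x ∈ singles grp ∩ C then (arrivalValue f ω x)⁺ else 0)
      ≤ f (state f ω r) + ∑ x ∈ (singles grp)ᶜ ∩ C, lateValue f ω x
        + ∑ x ∈ singles grp ∩ C, (arrivalValue f ω x)⁺ := by
    intro ω
    have h := hf.union_le (Finset.Subset.refl (state f ω r)) (C \ state f ω r)
      (fun x _ h => h)
    rw [Finset.union_sdiff_self_eq_union] at h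
    have h2 : ∑ x ∈ C \ state f ω r, marginal f (state f ω r) x
        ≤ ∑ x ∈ C \ state f ω r, (if x ∈ (singles grp)ᶜ then lateValue f ω x else 0)
          + ∑ x ∈ C \ state f ω r, (if x ∈ singles grp then (arrivalValue f ω x)⁺ else 0) := by
      rw [← Finset.sum_add_distrib]
      refine Finset.sum_le_sum fun x hx => ?_
      have hxS := (Finset.mem_sdiff.mp hx).2
      by_cases hs : x ∈ singles grp
      · simp only [Finset.mem_compl, hs, not_true_eq_false, if_false, if_true, zero_add]
        exact (hf.marginal_le (state_subset ω x) (fun h => absurd h hxS)).trans (le_posPart _)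
      · simp only [Finset.mem_compl, hs, not_false_eq_true, if_false, if_true, add_zero]
        exact hf.marginal_le (Finset.union_subset (Finset.filter_subset _ _) (state_subset ω x))
          (fun h => absurd h hxS)
    have split : ∀ (P : Finset α) (φ : α → ℝ), ∑ x ∈ C \ state f ω r, (if x ∈ P then φ x else 0)
        + ∑ x ∈ state f ω r, (if x ∈ P ∩ C then φ x else 0) = ∑ x ∈ P ∩ C, φ x := by
      intro P φ
      rw [Finset.sum_ite_mem, Finset.sum_ite_mem, ← Finset.sum_union]
      · congr 1
        ext x
        simp only [Finset.mem_union, Finset.mem_inter, Finset.mem_sdiff]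
        tauto
      · refine Finset.disjoint_left.mpr fun x hx hy => ?_
        simp only [Finset.mem_inter, Finset.mem_sdiff] at hx hy
        exact hx.1.2 hy.1
    have h3 := split (singles grp)ᶜ (lateValue f ω)
    have h4 := split (singles grp) (fun x => (arrivalValue f ω x)⁺)
    linarith
  have hsum := Finset.sum_le_sum (s := Finset.univ) (fun ω _ => key ω)
  simp only [Finset.sum_add_distrib] at hsum
  rw [sum_ite_state _ (lateValue f) (fun x hx ω y =>
      lateValue_resample ω (Finset.mem_compl.mp (Finset.mem_inter.mp hx).1) y),
    sum_ite_state _ (fun ω x => (arrivalValue f ω x)⁺) (fun x _ ω y => by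
      rw [arrivalValue_resample])] at hsum
  have e : total grp (fun ω x => prob f ω x * (arrivalValue f ω x)⁺) (singles grp ∩ C)
      = total grp (fun ω x => (arrivalValue f ω x)⁺) (singles grp ∩ C) / 2 := by
    rw [total, total, Finset.sum_div]
    refine Finset.sum_congr rfl fun ω _ => ?_
    rw [Finset.sum_div]
    refine Finset.sum_congr rfl fun x hx => ?_
    rw [prob_single ω (Finset.mem_inter.mp hx).1]
    ring
  rw [e] at hsum
  unfold lateGain
  unfold total at hsum ⊢
  linarith

theorem half_single_le_gain (C : Finset α) :
    total grp (fun ω x => (arrivalValue f ω x)⁺) (singles grp ∩ C) / 2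
      ≤ total grp (gain f) (singles grp) := by
  refine le_trans (le_of_eq ?_) (total_mono gain_nonneg (Finset.inter_subset_left (s₂ := C)))
  rw [total, total, Finset.sum_div]
  refine Finset.sum_congr rfl fun ω _ => ?_
  rw [Finset.sum_div]
  refine Finset.sum_congr rfl fun x hx => ?_
  rw [gain, prob_single ω (Finset.mem_inter.mp hx).1]
  ring

/-- The tradeoffs of all groups with at least two elements together. -/
theorem total_tradeoff (hf : IsSubmodular f) {C : Finset α} (hC : IsIndep grp C)
    {κ₁ κ₂ κ₃ : ℝ} (h1 : 0 ≤ κ₁) (h2 : 0 ≤ κ₂) (h3 : 0 ≤ κ₃) (h3' : κ₃ ≤ 8)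
    (h12 : 7.12 ≤ κ₁ + κ₂) (h13 : 10.98 ≤ κ₁ + κ₃) :
    2 * total grp (lateValue f) ((singles grp)ᶜ ∩ C)
      ≤ κ₁ * total grp (gain f) (singles grp)ᶜ + κ₂ * total grp (gain f) ((singles grp)ᶜ \ C)
        + κ₃ * total grp (lateGain f) ((singles grp)ᶜ ∩ C) := by
  simp only [total, Finset.mul_sum (s := (Finset.univ : Finset (Run grp))),
    ← Finset.sum_add_distrib]
  refine Finset.sum_le_sum fun ω _ => ?_
  have fib : ∀ (P : α → Prop) [DecidablePred P] (φ : α → ℝ),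
      ∑ x ∈ (singles grp)ᶜ.filter P, φ x
        = ∑ j ∈ Finset.univ.filter (fun j => groupSize grp j ≠ 1),
          ∑ x ∈ (members grp j).filter P, φ x := by
    intro P _ φ
    rw [← Finset.sum_fiberwise_of_maps_to (s := (singles grp)ᶜ.filter P)
      (t := Finset.univ.filter (fun j => groupSize grp j ≠ 1)) (g := grp)]
    · refine Finset.sum_congr rfl fun j hj => Finset.sum_congr ?_ fun _ _ => rfl
      have hj := (Finset.mem_filter.mp hj).2
      ext x
      simp only [Finset.mem_filter, Finset.mem_compl, mem_singles, mem_members]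
      constructor
      · rintro ⟨⟨_, h⟩, h'⟩
        exact ⟨h', h⟩
      · rintro ⟨rfl, h⟩
        exact ⟨⟨hj, h⟩, rfl⟩
    · intro x hx
      have := (Finset.mem_filter.mp hx).1
      rw [Finset.mem_compl, mem_singles] at this
      exact Finset.mem_filter.mpr ⟨Finset.mem_univ _, this⟩
  have fib' := fib (fun _ => True) (gain f ω)
  simp only [Finset.filter_true] at fib'
  rw [← Finset.filter_mem_eq_inter, ← Finset.filter_notMem_eq_sdiff, fib, fib, fib, fib',
    Finset.mul_sum, Finset.mul_sum, Finset.mul_sum, Finset.mul_sum, ← Finset.sum_add_distrib,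
    ← Finset.sum_add_distrib]
  refine Finset.sum_le_sum fun j hj => ?_
  have hj := (Finset.mem_filter.mp hj).2
  have h := group_tradeoff hC (state f ω j) j hj (lateValue f ω) (by
    rintro x rfl
    exact lateValue_le hf ω (fun hx => hj (mem_singles.mp hx))) h1 h2 h3 h3' h12 h13
  have e : ∀ x ∈ members grp j, acceptProb f grp (state f ω j) x * (marginal f (state f ω j) x)⁺
      = gain f ω x := by
    intro x hx
    rw [mem_members] at hx
    subst hx
    rfl
  have e' : ∀ x ∈ members grp j, acceptProb f grp (state f ω j) x * lateValue f ω x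
      = lateGain f ω x := by
    intro x hx
    rw [mem_members] at hx
    subst hx
    rfl
  rwa [Finset.sum_congr rfl e, Finset.sum_congr rfl (fun x hx => e x (Finset.mem_filter.mp hx).1),
    Finset.sum_congr rfl (fun x hx => e' x (Finset.mem_filter.mp hx).1)] at h

end Averages

/-! ### Mode B and the final linear combination. -/

section Discarding

variable {α : Type*} [Fintype α] [LinearOrder α] {r : ℕ} {grp : α → Fin r}
  {f : Finset α → ℝ}

/-- Keeping every accepted element outside the groups of size one with probability `1 / 2`. -/
theorem sum_keep_nonsingles_ge (hf : IsSubmodular f) (h0 : f ∅ = 0) (ω : Run grp) :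
    (Fintype.card (α → Bool) : ℝ) * ∑ x ∈ (state f ω r).filter (fun x => x ∉ singles grp),
        arrivalValue f ω x
      ≤ 2 * ∑ d : α → Bool, f (keep d ((state f ω r).filter (fun x => x ∉ singles grp))) := by
  set W := (state f ω r).filter (fun x => x ∉ singles grp) with hW
  have key : ∀ d : α → Bool, ∑ x ∈ W, (if d x = true then (1 : ℝ) else 0) * arrivalValue f ω x
      ≤ f (keep d W) := by
    intro d
    have hsub : keep d W ⊆ state f ω r :=
      (Finset.filter_subset _ _).trans (Finset.filter_subset _ _)
    have h := sum_marginal_eq_set f (fun x => (grp x : ℕ)) (fun x => (grp x).2) ∅ (keep d W)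
      (fun i => (Finset.card_le_card (Finset.filter_subset_filter _ hsub)).trans
        (state_filter_card_le ω i))
    simp only [Finset.empty_union, h0, zero_add] at h
    rw [h]
    simp only [ite_mul, one_mul, zero_mul, ← Finset.sum_filter]
    refine Finset.sum_le_sum fun x _ => ?_
    refine hf.marginal_le ?_ (fun h => absurd h (self_notMem_state ω x))
    rw [← state_filter_lt]
    exact Finset.filter_subset_filter _ hsub
  refine le_trans (le_of_eq ?_)
    (mul_le_mul_of_nonneg_left (Finset.sum_le_sum (s := Finset.univ) fun d _ => key d) zero_le_two)
  rw [Finset.sum_comm, Finset.mul_sum, Finset.mul_sum]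
  refine Finset.sum_congr rfl fun x _ => ?_
  rw [← Finset.sum_mul, ← mul_assoc, sum_coin]

/-- Three levels of halving. With `H` the accepted singles and `WC`, `WO` the accepted non-singles
inside and outside `C`, the coins are resolved on `H`, then on `WC`, then on `WO`. Where `H` is
kept, this ends in `f(S)`, `f(H ∪ WC)`, `f(H ∪ WO)` and `f(H) ≥ 0`, each with weight 1/8. Where `H`
is dropped, the sampled non-singles retain half of their arrival values on average. -/
theorem sum_keep_state_ge (hf : IsSubmodular f) (hnn : ∀ S, 0 ≤ f S) (h0 : f ∅ = 0)
    (C : Finset α) (ω : Run grp) :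
    (Fintype.card (α → Bool) : ℝ) *
      (2 * ∑ x ∈ state f ω r, (if x ∈ (singles grp)ᶜ then arrivalValue f ω x else 0)
        + f (state f ω r)
        + ∑ x ∈ state f ω r, (if x ∈ (singles grp)ᶜ ∩ C then lateValue f ω x else 0)
        + f ((state f ω r).filter (fun x => x ∈ singles grp ∪ Cᶜ)))
      ≤ 8 * ∑ d : α → Bool, f (keep d (state f ω r)) := by
  set S := state f ω r with hS
  set H := acceptedSingles f ω with hH
  set W := S.filter (fun x => x ∉ singles grp) with hW
  set WC := W.filter (fun x => x ∈ C) with hWC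
  set WO := W.filter (fun x => x ∉ C) with hWO
  have hHS : H ⊆ S := Finset.filter_subset _ _
  have eW : S \ H = W := by
    ext x
    simp only [hW, hH, acceptedSingles, ← hS, Finset.mem_sdiff, Finset.mem_filter]
    tauto
  have eWO : W \ WC = WO := by
    ext x
    simp only [hWC, hWO, Finset.mem_sdiff, Finset.mem_filter]
    tauto
  have hHW : Disjoint H W := by
    rw [← eW]
    exact Finset.disjoint_sdiff
  have hWCO : Disjoint WC WO := by
    rw [← eWO]
    exact Finset.disjoint_sdiff
  have hWCW : WC ⊆ W := Finset.filter_subset _ _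
  have hWOW : WO ⊆ W := Finset.filter_subset _ _
  have keep_empty : ∀ d : α → Bool, keep d (∅ : Finset α) = ∅ := fun d => by simp [keep]
  have k1 := hf.sum_keep_ge hHS ∅ (Finset.disjoint_empty_left _)
  have k2 := hf.sum_keep_ge hWCW H (hHW.mono_right hWCW)
  have k3 := hf.sum_keep_ge (Finset.Subset.refl WO) (H ∪ WC)
    (Finset.disjoint_union_left.mpr ⟨hHW.mono_right hWOW, hWCO⟩)
  have k4 := hf.sum_keep_ge (Finset.Subset.refl WO) H (hHW.mono_right hWOW)
  simp only [Finset.empty_union, eW] at k1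
  rw [eWO] at k2
  have e1 : H ∪ WC ∪ WO = S := by
    ext x
    simp only [hW, hH, hWC, hWO, acceptedSingles, ← hS, Finset.mem_union, Finset.mem_filter]
    tauto
  have e2 : H ∪ WO = S.filter (fun x => x ∈ singles grp ∪ Cᶜ) := by
    ext x
    simp only [hW, hH, hWO, acceptedSingles, ← hS, Finset.mem_union, Finset.mem_filter,
      Finset.mem_compl]
    tauto
  simp only [sdiff_self, Finset.bot_eq_empty, keep_empty, Finset.union_empty, e1, e2,
    Finset.sum_const, nsmul_eq_mul, Finset.card_univ] at k3 k4
  have k5 := sum_keep_nonsingles_ge hf h0 ω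
  rw [← hS, ← hW] at k5
  have e3 : ∑ x ∈ S, (if x ∈ (singles grp)ᶜ then arrivalValue f ω x else 0)
      = ∑ x ∈ W, arrivalValue f ω x := by
    simp only [hW, Finset.sum_filter, Finset.mem_compl]
  have e4 : ∑ x ∈ S, (if x ∈ (singles grp)ᶜ ∩ C then lateValue f ω x else 0)
      = ∑ x ∈ WC, lateValue f ω x := by
    simp only [hWC, hW, Finset.filter_filter, Finset.sum_filter, Finset.mem_compl,
      Finset.mem_inter]
  have k6 : ∑ x ∈ WC, lateValue f ω x ≤ f (H ∪ WC) := by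
    have hsub : WC ⊆ state f ω r := hWCW.trans (Finset.filter_subset _ _)
    have h := sum_marginal_eq_set f (fun x => (grp x : ℕ)) (fun x => (grp x).2) H WC
      (fun i => (Finset.card_le_card (Finset.filter_subset_filter _ hsub)).trans
        (state_filter_card_le ω i))
    rw [h]
    refine le_add_of_nonneg_of_le (hnn H) (Finset.sum_le_sum fun x hx => ?_)
    refine hf.marginal_le (Finset.union_subset_union_right ?_) fun h => ?_
    · rw [← state_filter_lt]
      exact Finset.filter_subset_filter _ hsub
    · rcases Finset.mem_union.mp h with h | h
      · exact Finset.mem_union_left _ h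
      · exact absurd h (self_notMem_state ω x)
  have k7 := mul_le_mul_of_nonneg_left k6 (Nat.cast_nonneg (α := ℝ) (Fintype.card (α → Bool)))
  have k8 := mul_nonneg (Nat.cast_nonneg (α := ℝ) (Fintype.card (α → Bool))) (hnn H)
  rw [e3, e4]
  linarith

/-- The accepted elements outside of `C`, with those of the groups of size one. -/
theorem gain_le_filter (hf : IsSubmodular f) (hnn : ∀ S, 0 ≤ f S) (h0 : f ∅ = 0) (C : Finset α) :
    total grp (gain f) ((singles grp)ᶜ \ C)
      ≤ 2 * ∑ ω : Run grp, f ((state f ω r).filter (fun x => x ∈ singles grp ∪ Cᶜ)) := by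
  set K := singles grp ∪ Cᶜ with hK
  -- Marginals within the filtered process are at least the arrival values, so its gains dominate
  -- `gain`.
  let w : Run grp → α → ℝ := fun ω x => marginal f ((state f ω (grp x)).filter (fun y => y ∈ K)) x
  have hw : ∀ ω x, arrivalValue f ω x ≤ w ω x := fun ω x =>
    hf.marginal_le (Finset.filter_subset _ _) (fun h => absurd h (self_notMem_state ω x))
  have key : ∀ ω : Run grp,
      ∑ x ∈ state f ω r, (if x ∈ K then 2 * w ω x - (w ω x)⁺ else 0) + ∑ x ∈ K, (w ω x)⁻
        ≤ 2 * f ((state f ω r).filter (fun x => x ∈ K)) := by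
    intro ω
    have hsub : (state f ω r).filter (fun x => x ∈ K) ⊆ state f ω r := Finset.filter_subset _ _
    obtain ⟨Y, _, h⟩ := hf.exists_dominated_set (fun x => (grp x : ℕ)) (fun x => (grp x).2) 2 ∅
      ((state f ω r).filter (fun x => x ∈ K)) K
      (fun i => (Finset.card_le_card (Finset.filter_subset_filter _ hsub)).trans
        (state_filter_card_le ω i))
    have hfil : ∀ x, ((state f ω r).filter (fun x => x ∈ K)).filter
        (fun y => (grp y : ℕ) < grp x) = (state f ω (grp x)).filter (fun y => y ∈ K) := by
      intro x
      rw [Finset.filter_comm, state_filter_lt]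
    simp only [hfil, Finset.empty_union, h0] at h
    have e : ∑ x ∈ state f ω r, (if x ∈ K then 2 * w ω x - (w ω x)⁺ else 0)
        = ∑ x ∈ (state f ω r).filter (fun x => x ∈ K),
          (2 * w ω x - (if x ∈ K then (w ω x)⁺ else w ω x)) := by
      rw [← Finset.sum_filter]
      refine Finset.sum_congr rfl fun x hx => ?_
      rw [if_pos (Finset.mem_filter.mp hx).2]
    have := hnn ((state f ω r).filter (fun x => x ∈ K) ∪ Y)
    rw [e, Finset.sum_sub_distrib]
    simp only [w]
    linarith
  have hsum := Finset.sum_le_sum (s := Finset.univ) (fun ω _ => key ω)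
  rw [Finset.sum_add_distrib, sum_ite_state K (fun ω x => 2 * w ω x - (w ω x)⁺)
      (fun x _ ω y => by simp only [w, state_resample f ω _ _ le_rfl]),
    total, ← Finset.sum_add_distrib, ← Finset.mul_sum] at hsum
  refine le_trans ?_ hsum
  have hsubK : (singles grp)ᶜ \ C ⊆ K := by
    intro x hx
    rw [Finset.mem_sdiff] at hx
    exact Finset.mem_union_right _ (Finset.mem_compl.mpr hx.2)
  refine (total_mono gain_nonneg hsubK).trans (Finset.sum_le_sum fun ω _ => ?_)
  rw [← Finset.sum_add_distrib]
  refine Finset.sum_le_sum fun x _ => ?_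
  have h1 := posPart_sub_negPart (w ω x)
  have h2 : gain f ω x ≤ prob f ω x * (w ω x)⁺ :=
    mul_le_mul_of_nonneg_left (posPart_mono (hw ω x)) (prob_nonneg ω x)
  have h3 := mul_nonneg (sub_nonneg.mpr (prob_le_half (f := f) ω x)) (negPart_nonneg (w ω x))
  refine h2.trans ?_
  generalize (w ω x)⁺ = p at *
  generalize (w ω x)⁻ = m at *
  rw [← h1]
  linarith

theorem total_keep_ge (hf : IsSubmodular f) (hnn : ∀ S, 0 ≤ f S) (h0 : f ∅ = 0) (C : Finset α) :
    (Fintype.card (α → Bool) : ℝ) *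
      (2 * (total grp (gain f) (singles grp)ᶜ - total grp (loss f) (singles grp)ᶜ)
        + ∑ ω : Run grp, f (state f ω r) + total grp (lateGain f) ((singles grp)ᶜ ∩ C)
        + total grp (gain f) ((singles grp)ᶜ \ C) / 2)
      ≤ 8 * ∑ ω : Run grp, ∑ d : α → Bool, f (keep d (state f ω r)) := by
  have h := Finset.sum_le_sum (s := (Finset.univ : Finset (Run grp)))
    (fun ω _ => sum_keep_state_ge hf hnn h0 C ω)
  rw [← Finset.mul_sum, ← Finset.mul_sum] at h
  refine le_trans (mul_le_mul_of_nonneg_left ?_ (Nat.cast_nonneg _)) h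
  rw [Finset.sum_add_distrib, Finset.sum_add_distrib, Finset.sum_add_distrib, ← Finset.mul_sum,
    sum_ite_state _ (arrivalValue f) (fun x _ ω y => arrivalValue_resample ω x y),
    sum_ite_state _ (lateValue f) (fun x hx ω y =>
      lateValue_resample ω (Finset.mem_compl.mp (Finset.mem_inter.mp hx).1) y)]
  have e : total grp (fun ω x => prob f ω x * arrivalValue f ω x) (singles grp)ᶜ
      = total grp (gain f) (singles grp)ᶜ - total grp (loss f) (singles grp)ᶜ := by
    simp only [total, ← Finset.sum_sub_distrib]
    refine Finset.sum_congr rfl fun ω _ => Finset.sum_congr rfl fun x _ => ?_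
    rw [gain, loss, ← mul_sub, posPart_sub_negPart]
  have := gain_le_filter (grp := grp) hf hnn h0 C
  rw [e]
  unfold lateGain
  linarith

/-- The approximation guarantee for an arbitrary independent set, with the sum over all runs in
place of the expected value. -/
theorem card_mul_le (hf : IsSubmodular f) (hnn : ∀ S, 0 ≤ f S) (h0 : f ∅ = 0) {C : Finset α}
    (hC : IsIndep grp C) :
    (Fintype.card (α → Bool) : ℝ) * (Fintype.card (Run grp) : ℝ) * f C
      ≤ (1 + 2 * Real.exp 1) * (2 * (Fintype.card (α → Bool) : ℝ) * ∑ ω : Run grp, f (state f ω r)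
        + ∑ ω : Run grp, ∑ d : α → Bool, f (keep d (state f ω r))) := by
  have he1 := Real.exp_one_gt_d9
  have he2 := Real.exp_one_lt_d9
  generalize Real.exp 1 = e at *
  have i0 := sum_union_ge (grp := grp) hf hnn C
  have i1 := sum_union_le (grp := grp) hf C
  have i2 := gain_add_loss_le (grp := grp) hf hnn h0
  have i3 := gain_add_lateGain_le (grp := grp) hf hnn h0 C
  have i4 := half_single_le_gain (grp := grp) (f := f) C
  have i5 := total_keep_ge (grp := grp) hf hnn h0 C
  -- In the target `a` has coefficient `17/8 (1 + 2e)`, of which 2 is used by `sum_union_le`. The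
  -- rest is spent through `ha`. Then `κ₁`, `κ₂`, `κ₃` are exactly the amounts available for the
  -- non-single gains, the gains outside `C`, and the late gains in `C`; the final 2 in `κ₃` comes
  -- from `sum_union_le`. Numerically `κ₁ + κ₂ ≈ 7.1204` and `κ₁ + κ₃ ≈ 10.9824`.
  have i6 := total_tradeoff hf hC (κ₁ := 7 / 16 * (17 / 8 * (1 + 2 * e) - 2) + (1 + 2 * e) / 4)
    (κ₂ := (1 + 2 * e) / 16) (κ₃ := (17 / 8 * (1 + 2 * e) - 2) / 8 + (1 + 2 * e) / 8 + 2)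
    (by linarith) (by linarith) (by linarith) (by linarith) (by linarith) (by linarith)
  have hGs := total_nonneg (gain_nonneg (grp := grp) (f := f)) (singles grp)
  have hL := total_nonneg (loss_nonneg (grp := grp) (f := f)) (singles grp)ᶜ
  rw [total_univ] at i2 i3
  have hD : (0 : ℝ) ≤ Fintype.card (α → Bool) := Nat.cast_nonneg _
  generalize total grp (gain f) (singles grp)ᶜ = Gw at *
  generalize total grp (gain f) (singles grp) = Gs at *
  generalize total grp (loss f) (singles grp)ᶜ = L at *
  generalize total grp (gain f) ((singles grp)ᶜ \ C) = Go at *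
  generalize total grp (lateGain f) ((singles grp)ᶜ ∩ C) = Tc at *
  generalize total grp (lateValue f) ((singles grp)ᶜ ∩ C) = Mt at *
  generalize total grp (fun ω x => (arrivalValue f ω x)⁺) (singles grp ∩ C) = Vs at *
  generalize ∑ ω : Run grp, f (state f ω r ∪ C) = U at *
  generalize ∑ ω : Run grp, ∑ d : α → Bool, f (keep d (state f ω r)) = B at *
  generalize ∑ ω : Run grp, f (state f ω r) = a at *
  generalize (Fintype.card (α → Bool) : ℝ) = D at *
  -- The combination of `i2` with weight 3/8 and `i3` with weight 1/16.
  have ha : 7 / 16 * (Gw + Gs) + 3 / 4 * L + Tc / 8 ≤ a := by linarith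
  have hA := mul_le_mul_of_nonneg_left ha
    (show (0 : ℝ) ≤ 17 / 8 * (1 + 2 * e) - 2 by linarith)
  have hGs' := mul_le_mul_of_nonneg_left i4
    (show (0 : ℝ) ≤ 7 / 16 * (17 / 8 * (1 + 2 * e) - 2) by linarith)
  -- The loss term in `ha` more than compensates for the loss subtracted in mode B.
  have hL' := mul_nonneg (show (0 : ℝ) ≤ 3 / 4 * (17 / 8 * (1 + 2 * e) - 2) - (1 + 2 * e) / 4
    by linarith) hL
  have hGs'' := mul_nonneg (show (0 : ℝ) ≤ 7 / 16 * (17 / 8 * (1 + 2 * e) - 2) - 2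
    by linarith) hGs
  have main : (Fintype.card (Run grp) : ℝ) * f C ≤ (1 + 2 * e) * (2 * a + (2 * (Gw - L) + a + Tc
      + Go / 2) / 8) := by
    linarith
  calc D * (Fintype.card (Run grp) : ℝ) * f C = D * ((Fintype.card (Run grp) : ℝ) * f C) := by ring
    _ ≤ D * ((1 + 2 * e) * (2 * a + (2 * (Gw - L) + a + Tc + Go / 2) / 8)) :=
        mul_le_mul_of_nonneg_left main hD
    _ = (1 + 2 * e) * (2 * D * a + D * (2 * (Gw - L) + a + Tc + Go / 2) / 8) := by ring
    _ ≤ (1 + 2 * e) * (2 * D * a + B) :=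
        mul_le_mul_of_nonneg_left (by linarith) (by linarith)

end Discarding

/-! ### From outcomes of the algorithm to runs. -/

section Outcomes

variable {α : Type*} [Fintype α] [LinearOrder α] {r : ℕ} {grp : α → Fin r}

/-- The run of an outcome of the algorithm: in mode `C` the coins are reversed. -/
def toRun (ω : Outcome grp) : Run grp := (ω.1, fun j => accepts ω j)

theorem step_eq (f : Finset α → ℝ) (ω : Outcome grp) (S : Finset α) (j : Fin r) :
    step f ω S j = S ∪ added f (toRun ω) S j := by
  have hp : pick f (toRun ω) S j = dynkin (marginal f S) (stream ω j) := rfl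
  rw [added, dif_pos j.2, Fin.eta, hp, step]
  cases dynkin (marginal f S) (stream ω j) with
  | none => simp
  | some x => by_cases h : accepts ω j = true <;> simp [toRun, h]

theorem selected_eq (f : Finset α → ℝ) (ω : Outcome grp) :
    selected f ω = state f (toRun ω) r := by
  have key : ∀ n (hn : n ≤ r), ((List.finRange r).take n).foldl (step f ω) ∅
      = state f (toRun ω) n := by
    intro n
    induction n with
    | zero => intro _; rfl
    | succ n ih =>
      intro hn
      have hlt : n < (List.finRange r).length := by simpa using hn
      rw [List.take_succ_eq_append_getElem hlt, List.foldl_append, ih (by omega)]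
      simp [step_eq, state]
  have h := key r le_rfl
  rwa [List.take_of_length_le (by simp)] at h

theorem state_isIndep (f : Finset α → ℝ) (ω : Run grp) : IsIndep grp (state f ω r) := by
  intro j
  refine (Finset.card_le_card ?_).trans (state_filter_card_le (f := f) ω j)
  intro x hx
  rw [Finset.mem_filter] at hx ⊢
  exact ⟨hx.1, by rw [hx.2]⟩

theorem output_subset (f : Finset α → ℝ) (ω : Outcome grp) : output f ω ⊆ selected f ω := by
  unfold output
  split
  · exact Finset.Subset.refl _
  · exact Finset.filter_subset _ _
  · exact Finset.Subset.refl _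

theorem output_isIndep (f : Finset α → ℝ) (ω : Outcome grp) : IsIndep grp (output f ω) := by
  intro j
  have h := state_isIndep f (toRun ω) j
  rw [← selected_eq] at h
  exact (Finset.card_le_card (Finset.filter_subset_filter _ (output_subset f ω))).trans h

theorem sum_output (f : Finset α → ℝ) :
    ∑ ω : Outcome grp, f (output f ω)
      = 2 * (Fintype.card (α → Bool) : ℝ) * ∑ ω : Run grp, f (state f ω r)
        + ∑ ω : Run grp, ∑ d : α → Bool, f (keep d (state f ω r)) := by
  have hmode : ∀ g : Mode → ℝ, ∑ m, g m = g Mode.A + g Mode.B + g Mode.C := by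
    intro g
    have : (Finset.univ : Finset Mode) = {Mode.A, Mode.B, Mode.C} := rfl
    rw [this, Finset.sum_insert (by decide), Finset.sum_insert (by decide),
      Finset.sum_singleton, add_assoc]
  have hA : ∀ o (c : Fin r → Bool) (d : α → Bool),
      output f ((o, Mode.A, c, d) : Outcome grp) = state f (o, c) r :=
    fun o c d => selected_eq f (o, Mode.A, c, d)
  have hB : ∀ o (c : Fin r → Bool) (d : α → Bool),
      output f ((o, Mode.B, c, d) : Outcome grp) = keep d (state f (o, c) r) :=
    fun o c d => congrArg (keep d) (selected_eq f (o, Mode.B, c, d))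
  have hC : ∀ o (c : Fin r → Bool) (d : α → Bool),
      output f ((o, Mode.C, c, d) : Outcome grp) = state f (o, fun j => !(c j)) r :=
    fun o c d => selected_eq f (o, Mode.C, c, d)
  -- Reversing all coins is a bijection, so mode C contributes the same sum as mode A.
  have hflip : ∀ o, ∑ c : Fin r → Bool, f (state f ((o, fun j => !(c j)) : Run grp) r)
      = ∑ c : Fin r → Bool, f (state f ((o, c) : Run grp) r) := by
    intro o
    refine Fintype.sum_equiv ⟨fun c j => !(c j), fun c j => !(c j), ?_, ?_⟩ _ _ (fun _ => rfl)
    · intro c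
      ext j
      simp
    · intro c
      ext j
      simp
  simp only [Fintype.sum_prod_type, hmode, hA, hB, hC, Finset.sum_const, nsmul_eq_mul,
    Finset.card_univ, ← Finset.mul_sum, hflip, Finset.sum_add_distrib]
  ring

theorem card_outcome :
    (Fintype.card (Outcome grp) : ℝ)
      = 3 * ((Fintype.card (α → Bool) : ℝ) * (Fintype.card (Run grp) : ℝ)) := by
  have h3 : Fintype.card Mode = 3 := rfl
  simp only [Fintype.card_prod, h3]
  push_cast
  ring

end Outcomes

end ContiguousSecretary

/-- The groups are the fibres of `grp`, numbered in their (arbitrary) order of arrival. The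
algorithm always outputs an independent set of the partition matroid, and the expected value of
its output is at least the optimum divided by `3 + 6e`. -/
theorem mainTheorem8 {α : Type*} [Fintype α] [LinearOrder α] {r : ℕ} (grp : α → Fin r)
    (f : Finset α → ℝ) (hnonneg : ∀ S : Finset α, 0 ≤ f S) (hempty : f ∅ = 0)
    (hsub : ContiguousSecretary.IsSubmodular f) :
    (∀ ω : ContiguousSecretary.Outcome grp,
        ContiguousSecretary.IsIndep grp (ContiguousSecretary.output f ω)) ∧
      ContiguousSecretary.opt grp f ≤
        (3 + 6 * Real.exp 1) * ContiguousSecretary.expectedValue grp f := by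
  refine ⟨ContiguousSecretary.output_isIndep f, ?_⟩
  unfold ContiguousSecretary.opt
  refine Finset.sup'_le _ _ fun C hC => ?_
  have hC := (Finset.mem_filter.mp hC).2
  have h := ContiguousSecretary.card_mul_le hsub hnonneg hempty hC
  rw [← ContiguousSecretary.sum_output] at h
  have hpos : (0 : ℝ) < (Fintype.card (α → Bool) : ℝ)
      * (Fintype.card (ContiguousSecretary.Run grp) : ℝ) := by
    have h1 : 0 < Fintype.card (α → Bool) := Fintype.card_pos
    have : Nonempty (ContiguousSecretary.Run grp) :=
      ⟨(fun _ => (Fintype.equivFin _).symm, fun _ => true)⟩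
    have h2 : 0 < Fintype.card (ContiguousSecretary.Run grp) := Fintype.card_pos
    exact mul_pos (by exact_mod_cast h1) (by exact_mod_cast h2)
  -- The number of modes in `card_outcome` turns the factor `1 + 2e` into `3 + 6e`.
  rw [ContiguousSecretary.expectedValue, ContiguousSecretary.card_outcome, mul_div_assoc',
    le_div_iff₀ (by positivity)]
  linarith
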